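/- **Theorem 2 (asymptotics of $J_B$ to all orders when $\sigma=1/2$).** Let $0<\delta<1$. For $t>0$ large put $\lambda_c=\dfrac{t^{\delta-1}}{1-t^{\delta-1}}$ and let $\lambda$ satisfy $\lambda_c\le\lambda\le t^{1-\delta}-1$. Let $F(z;\lambda)=(1-z)\ln(1-z)+z\ln z+z\ln\lambda$ with branch cuts $(-\infty,0]$ and $[1,\infty)$ (principal branches), and $$J_B(t;\lambda)=\int_{1-t^{\delta-1}}^{\infty e^{i\phi}}(1-z)^{-1/2}e^{itF(z;\lambda)}\,dz ,$$ where $0<\phi<\pi/2$ if $\ln\lambda\ge0$ and $0<\phi<\arctan(\pi/|\ln\lambda|)$ if $\ln\lambda<0$; the integral converges absolutely along the ray from $1-t^{\delta-1}$ in direction $e^{i\phi}$. Define $\Lambda$ by $\lambda=\lambda_c(1+\Lambda)$ and $\omega=\sqrt{\lambda_c t/2}\;\dfrac{\ln(1+\Lambda)}{1+\lambda_c}$. Let $m\ge4$ be a natural number, let $\epsilon>0$, and let $a=a(t)>0$ satisfy, as $t\to\infty$, $$t^{\epsilon-\frac{\delta}{2}+\frac{\delta}{4m+2}}\ll a\ll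 t^{-\frac{\delta}{2}+\frac{\delta}{4m-2}},$$ where $f\ll g$ means $f=O(g)$ (so the case $f=o(g)$ is included). Put $k=t^{\delta-1}(1-a)$ and, for $j\ge0$, $$T_j(t;\lambda)=-\left[\left(\frac{-1}{it\,\partial F/\partial z}\cdot\frac{\partial}{\partial z}\right)^{j}\left(\frac{(1-z)^{-1/2}}{it\,\partial F/\partial z}\right)\right]e^{itF(z;\lambda)}\Bigg|_{z=1-k}.$$ Then, as $t\to\infty$, $$J_B(t;\lambda)=\sum_{j=0}^{m-3}T_j(t;\lambda)+e^{itF(1-t^{\delta-1};\lambda)-i\omega^2}\,t^{-1/2}\sqrt{\frac{2}{1+\lambda_c}}\int_{\omega}^{\omega+a\sqrt{\lambda_c t/2}}e^{i\xi^2}\,d\xi$$ $$\qquad+O\!\left((4m-5)!!\,t^{-\frac12-\frac{(4m-5)\delta}{2}}(\ln t)^{\frac{4m-3}{2}}a^{-4m+4}\right)+O\!\left(t^{-\frac12+\frac{3\delta}{2}}a^4\right),$$ and, for each $0\le j\le m-3$, $$T_j(t;\lambda)=O\!\left((2j-1)!!\,t^{-\frac12-\frac{(2j+1)\delta}{2}}a^{-2j-1}\right),\qquad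 (-1)!!:=1.$$ The implied constants depend only on $\delta$; the bounds hold for all $t\ge t_0$, where $t_0$ may depend on $\delta$, $m$, $\epsilon$ and the function $a$. Neither the constants nor $t_0$ depend on $\lambda$ or $\phi$. -/

import Mathlib

open Filter Asymptotics MeasureTheory

noncomputable section

namespace JBAsymptotics

/-- The phase `F(z;λ) = (1-z) ln(1-z) + z ln z + z ln λ`. With the principal branch of the
logarithm its cuts are `(-∞,0]` and `[1,∞)`. -/
def F (z : ℂ) (lam : ℝ) : ℂ :=
  (1 - z) * Complex.log (1 - z) + z * Complex.log z + z * (Real.log lam : ℂ)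

/-- The integrand `(1-z)^(-1/2) z^(σ-1/2) exp(i t F(z;λ))`. -/
def integrand (σ t lam : ℝ) (z : ℂ) : ℂ :=
  (1 - z) ^ (-(1 / 2) : ℂ) * z ^ ((σ : ℂ) - 1 / 2) * Complex.exp (Complex.I * t * F z lam)

/-- The endpoint `1 - t^(δ-1)`. -/
def z₀ (δ t : ℝ) : ℝ := 1 - t ^ (δ - 1)

/-- The directions `φ` along which the contour may go to infinity. -/
def AdmissibleAngle (lam φ : ℝ) : Prop :=
  0 < φ ∧ (0 ≤ Real.log lam → φ < Real.pi / 2) ∧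
    (Real.log lam < 0 → φ < Real.arctan (Real.pi / |Real.log lam|))

/-- The integrand of `J_B` pulled back to the ray `z = 1 - t^(δ-1) + R e^{iφ}`, `R > 0`,
including the Jacobian `dz/dR = e^{iφ}`. -/
def rayIntegrand (δ σ t lam φ R : ℝ) : ℂ :=
  integrand σ t lam ((z₀ δ t : ℂ) + R * Complex.exp (Complex.I * φ)) *
    Complex.exp (Complex.I * φ)

/-- `J_B(t;λ,δ,σ)`, the integral of `integrand` from `1 - t^(δ-1)` to `∞ e^{iφ}`. -/
def JB (δ σ t lam φ : ℝ) : ℂ :=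
  ∫ R in Set.Ioi (0 : ℝ), rayIntegrand δ σ t lam φ R

/-- The critical value `λ_c = t^(δ-1) / (1 - t^(δ-1))`. -/
def lamC (δ t : ℝ) : ℝ := t ^ (δ - 1) / (1 - t ^ (δ - 1))

/-- `Λ`, given by `λ = λ_c (1 + Λ)`. -/
def bigLam (δ t lam : ℝ) : ℝ := lam / lamC δ t - 1

/-- `ω = √(λ_c t / 2) · ln(1 + Λ) / (1 + λ_c)`. -/
def omega (δ t lam : ℝ) : ℝ :=
  Real.sqrt (lamC δ t * t / 2) * (Real.log (1 + bigLam δ t lam) / (1 + lamC δ t))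

/-- The splitting parameter `k = t^(δ-1) (1 - a)`. -/
def splitK (δ t a : ℝ) : ℝ := t ^ (δ - 1) * (1 - a)

/-- `∂F/∂z`. -/
def dF (lam : ℝ) (z : ℂ) : ℂ := deriv (fun w => F w lam) z

/-- The operator `(-1 / (i t ∂F/∂z)) · ∂/∂z`. -/
def ibpOp (t lam : ℝ) (h : ℂ → ℂ) : ℂ → ℂ :=
  fun z => -1 / (Complex.I * t * dF lam z) * deriv h z

/-- The function `(1-z)^(-1/2) / (i t ∂F/∂z)`. -/
def ibpStart (t lam : ℝ) : ℂ → ℂ :=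
  fun z => (1 - z) ^ (-(1 / 2) : ℂ) / (Complex.I * t * dF lam z)

/-- The boundary term `T_j(t;λ)`: minus the `j`-th power of `ibpOp` applied to `ibpStart`,
times `exp(i t F)`, at `z = 1 - k`. -/
def T (t lam k : ℝ) (j : ℕ) : ℂ :=
  -((ibpOp t lam)^[j] (ibpStart t lam) (1 - (k : ℂ))) *
    Complex.exp (Complex.I * t * F (1 - (k : ℂ)) lam)

/-- The truncated Fresnel term
`exp(i t F(1 - t^(δ-1);λ) - i ω²) t^(-1/2) √(2/(1+λ_c)) ∫_ω^{ω + a √(λ_c t/2)} e^{iξ²} dξ`. -/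
def fresnelTerm (δ t lam a : ℝ) : ℂ :=
  Complex.exp (Complex.I * t * F (z₀ δ t : ℂ) lam - Complex.I * (omega δ t lam : ℂ) ^ 2) *
    ((t ^ (-(1 / 2) : ℝ) * Real.sqrt (2 / (1 + lamC δ t)) : ℝ) : ℂ) *
    ∫ ξ in (omega δ t lam)..(omega δ t lam + a * Real.sqrt (lamC δ t * t / 2)),
      Complex.exp (Complex.I * (ξ : ℂ) ^ 2)

/-- `(4m-5)!! t^(-1/2-(4m-5)δ/2) (ln t)^((4m-3)/2) a^(-4m+4)`. -/
def err₁ (δ : ℝ) (m : ℕ) (t a : ℝ) : ℝ :=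
  (Nat.doubleFactorial (4 * m - 5) : ℝ) * t ^ (-(1 / 2) - (4 * (m : ℝ) - 5) * δ / 2) *
    Real.log t ^ ((4 * (m : ℝ) - 3) / 2) * a ^ (-(4 * (m : ℝ)) + 4)

/-- `t^(-1/2+3δ/2) a^4`. -/
def err₂ (δ t a : ℝ) : ℝ := t ^ (-(1 / 2) + 3 * δ / 2) * a ^ 4

/-- `(2j-1)!! t^(-1/2-(2j+1)δ/2) a^(-2j-1)`, where `(-1)!! = 1` (in Lean: `0‼ = 1`). -/
def boundT (δ : ℝ) (j : ℕ) (t a : ℝ) : ℝ :=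
  (Nat.doubleFactorial (2 * j - 1) : ℝ) * t ^ (-(1 / 2) - (2 * (j : ℝ) + 1) * δ / 2) *
    a ^ (-(2 * (j : ℝ)) - 1)

end JBAsymptotics

end

/-!
By Cauchy's theorem and the exponential decay of `exp (i t F)` in the upper half plane, the contour
may be replaced by the real segment from `1 - t^(δ-1)` to `1 - k` followed by the ray from `1 - k`
in the direction `1 + i / log t`. With this slope `log λ / log t ≥ -1` for all `λ ≥ λ_c`, so the
growth of `|λ^(i t z)|` cannot outweigh the decay of the other factor of `exp (i t F)`.

On the ray, repeated integration by parts has a closed form. With `u = (∂F/∂z)⁻¹`, the `j`-th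
amplitude is a unimodular multiple of
`t^(-j-1) (1 - z)^(-1/2) (z (1 - z))^(-j) u^(j+1) P_j(z, u)`, where the polynomial `P_j` has degree
at most `j` in `u`; its coefficient at `u^j` is, up to sign, `(2j-1)!!`, and this gives the bound
for `T_j`.

On the segment, write `z = 1 - p + p s` with `p = t^(δ-1)`. There the phase is real and differs
from its quadratic Taylor polynomial at `s = 0` by `O(t p s³)`, while the amplitude differs from its
value at `s = 0` by a relative error `O(s)`. Completing the square turns the quadratic model into
the Fresnel term.
-/

namespace JBAsymptotics

section Bivariate

open Polynomial Bivariate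

/-- The partial derivative of `p(X, Y)` with respect to `X`, where `R[X][Y]` is the ring of
polynomials in `Y` over `R[X]`. -/
noncomputable def derivativeX {R : Type*} [CommRing R] : R[X][Y] →ₗ[R] R[X][Y] :=
  (PolynomialModule.equivPolynomialSelf.restrictScalars R).toLinearMap ∘ₗ
    (derivative'.mapCoeffs (R := R)).toLinearMap

theorem coeff_derivativeX {R : Type*} [CommRing R] (p : R[X][Y]) (n : ℕ) :
    (derivativeX p).coeff n = derivative (p.coeff n) := rfl

theorem derivativeX_monomial {R : Type*} [CommRing R] (n : ℕ) (q : R[X]) :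
    derivativeX (monomial n q) = monomial n (derivative q) := by
  ext1 i
  rw [coeff_derivativeX, coeff_monomial, coeff_monomial]
  split_ifs <;> simp

theorem hasDerivAt_evalEval {𝕜 : Type*} [NontriviallyNormedField 𝕜] (p : 𝕜[X][Y]) {u : 𝕜 → 𝕜}
    {u' x : 𝕜} (hu : HasDerivAt u u' x) :
    HasDerivAt (fun y => p.evalEval y (u y))
      ((derivativeX p).evalEval x (u x) + u' * (derivative p).evalEval x (u x)) x := by
  induction p using Polynomial.induction_on' with
  | add p q hp hq =>
    simp only [map_add, evalEval_add]
    exact (hp.add hq).congr_deriv (by ring)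
  | monomial n q =>
    rw [derivativeX_monomial, derivative_monomial]
    simp only [← C_mul_X_pow_eq_monomial, evalEval_mul, evalEval_pow, evalEval_X, evalEval_C,
      eval_mul, eval_natCast]
    exact ((q.hasDerivAt x).mul (hu.pow n)).congr_deriv (by simp only [Pi.pow_apply]; ring)

theorem exists_norm_eval_le {𝕜 : Type*} [NormedField 𝕜] (p : 𝕜[X]) {d : ℕ} (hp : p.natDegree ≤ d)
    {r : ℝ} (hr : 0 < r) :
    ∃ K : ℝ, 0 ≤ K ∧ ∀ x : 𝕜, r ≤ ‖x‖ → ‖p.eval x‖ ≤ K * ‖x‖ ^ d := by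
  refine ⟨∑ i ∈ Finset.range (d + 1), ‖p.coeff i‖ * (r ^ (d - i))⁻¹, by positivity, fun x hx => ?_⟩
  rw [eval_eq_sum_range' (Nat.lt_succ_of_le hp), Finset.sum_mul]
  refine norm_sum_le_of_le _ fun i hi => ?_
  have hid : i ≤ d := Finset.mem_range_succ_iff.1 hi
  have hpow : ‖x‖ ^ i * r ^ (d - i) ≤ ‖x‖ ^ d := by
    calc ‖x‖ ^ i * r ^ (d - i) ≤ ‖x‖ ^ i * ‖x‖ ^ (d - i) := by gcongr
      _ = ‖x‖ ^ d := by rw [← pow_add, Nat.add_sub_cancel' hid]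
  rw [norm_mul, norm_pow, mul_assoc]
  gcongr
  rwa [← div_eq_inv_mul, le_div_iff₀ (by positivity)]

theorem exists_norm_evalEval_le {𝕜 : Type*} [NormedField 𝕜] (p : 𝕜[X][Y]) {d n : ℕ}
    (hpX : ∀ l, (p.coeff l).natDegree ≤ d) (hpY : p.natDegree ≤ n) {r : ℝ} (hr : 0 < r) :
    ∃ K : ℝ, 0 ≤ K ∧ ∀ (x y : 𝕜) (B : ℝ), r ≤ ‖x‖ → 1 ≤ B → ‖y‖ ≤ B →
      ‖p.evalEval x y‖ ≤ K * ‖x‖ ^ d * B ^ n := by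
  choose K hK0 hK using fun l => exists_norm_eval_le (p.coeff l) (hpX l) hr
  refine ⟨∑ l ∈ Finset.range (n + 1), K l, Finset.sum_nonneg fun l _ => hK0 l,
    fun x y B hx hB hy => ?_⟩
  rw [evalEval, eval_eq_sum_range' (Nat.lt_succ_of_le hpY), eval_finsetSum, Finset.sum_mul,
    Finset.sum_mul]
  refine norm_sum_le_of_le _ fun l hl => ?_
  rw [eval_mul, eval_pow, eval_C, norm_mul, norm_pow]
  have hyl : ‖y‖ ^ l ≤ B ^ n := (pow_le_pow_left₀ (norm_nonneg y) hy l).trans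
    (pow_le_pow_right₀ hB (Finset.mem_range_succ_iff.1 hl))
  have := hK0 l
  gcongr
  exact hK l x hx

/-- The polynomials `P_j(z, u)` such that the `j`-th integration by parts produces
`(1-z)^(-1/2) (z(1-z))^(-j) u^(j+1) P_j(z, u)`, where `u = (∂F/∂z)⁻¹`. The recursion expresses
that one step is `h ↦ u ∂h/∂z` and that `∂u/∂z = -u² / (z(1-z))`. -/
noncomputable def ibpPoly : ℕ → ℂ[X][Y]
  | 0 => 1
  | j + 1 => C (C (1 / 2) * X - C (j : ℂ) * (1 - 2 * X)) * ibpPoly j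
      + C (X * (1 - X)) * derivativeX (ibpPoly j)
      - X * ((j + 1 : ℂ[X][Y]) * ibpPoly j + X * derivative (ibpPoly j))

theorem coeff_zero_ibpPoly_succ (j : ℕ) :
    (ibpPoly (j + 1)).coeff 0 = (C (1 / 2) * X - C (j : ℂ) * (1 - 2 * X)) * (ibpPoly j).coeff 0
      + X * (1 - X) * derivative ((ibpPoly j).coeff 0) := by
  rw [ibpPoly, coeff_sub, coeff_add, coeff_C_mul, coeff_C_mul, coeff_derivativeX, coeff_X_mul_zero,
    sub_zero]

theorem coeff_succ_ibpPoly_succ (j l : ℕ) :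
    (ibpPoly (j + 1)).coeff (l + 1)
      = (C (1 / 2) * X - C (j : ℂ) * (1 - 2 * X)) * (ibpPoly j).coeff (l + 1)
        + X * (1 - X) * derivative ((ibpPoly j).coeff (l + 1))
        - (j + 1 + l : ℂ[X]) * (ibpPoly j).coeff l := by
  have hXd : (X * derivative (ibpPoly j)).coeff l = l * (ibpPoly j).coeff l := by
    cases l with
    | zero => simp
    | succ l => rw [coeff_X_mul, coeff_derivative]; push_cast; ring
  have hj : ((j + 1 : ℂ[X][Y]) * ibpPoly j).coeff l = (j + 1) * (ibpPoly j).coeff l := by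
    exact_mod_cast coeff_natCast_mul (p := ibpPoly j) (a := j + 1) (k := l)
  rw [ibpPoly, coeff_sub, coeff_add, coeff_C_mul, coeff_C_mul, coeff_derivativeX, coeff_X_mul,
    coeff_add, hXd, hj]
  ring

theorem natDegree_ibpPoly_le (j : ℕ) : (ibpPoly j).natDegree ≤ j := by
  rw [natDegree_le_iff_coeff_eq_zero]
  induction j with
  | zero => intro l hl; simp [ibpPoly, coeff_one, hl.ne']
  | succ j ih =>
    rintro (_ | l) hl
    · omega
    · rw [coeff_succ_ibpPoly_succ, ih (l + 1) (by omega), ih l (by omega)]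
      simp

theorem natDegree_coeff_ibpPoly_le (j l : ℕ) : ((ibpPoly j).coeff l).natDegree ≤ j := by
  have hstep : ∀ {p : ℂ[X]} {j : ℕ}, p.natDegree ≤ j →
      ((C (1 / 2) * X - C (j : ℂ) * (1 - 2 * X)) * p
        + X * (1 - X) * derivative p).natDegree ≤ j + 1 := by
    intro p j hp
    refine natDegree_add_le_of_degree_le (natDegree_mul_le.trans ?_) ?_
    · have : (C (1 / 2 : ℂ) * X - C (j : ℂ) * (1 - 2 * X)).natDegree ≤ 1 := by compute_degree
      omega
    · by_cases h0 : p.natDegree = 0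
      · simp [derivative_of_natDegree_zero h0]
      · have hX : (X * (1 - X) : ℂ[X]).natDegree ≤ 2 := by compute_degree
        have := natDegree_derivative_lt h0
        exact natDegree_mul_le.trans (by omega)
  induction j generalizing l with
  | zero => simp only [ibpPoly, coeff_one]; split_ifs <;> simp
  | succ j ih =>
    cases l with
    | zero => rw [coeff_zero_ibpPoly_succ]; exact hstep (ih 0)
    | succ l =>
      rw [coeff_succ_ibpPoly_succ]
      have hcast : (j + 1 + l : ℂ[X]) = C (j + 1 + l : ℂ) := by simp
      refine (natDegree_sub_le _ _).trans (max_le (hstep (ih (l + 1))) ?_)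
      rw [hcast]
      exact (natDegree_C_mul_le _ _).trans ((ih l).trans j.le_succ)

theorem coeff_self_ibpPoly (j : ℕ) :
    (ibpPoly j).coeff j = C ((-1) ^ j * (Nat.doubleFactorial (2 * j - 1) : ℂ)) := by
  induction j with
  | zero => simp [ibpPoly]
  | succ j ih =>
    have hdf : Nat.doubleFactorial (2 * (j + 1) - 1)
        = (2 * j + 1) * Nat.doubleFactorial (2 * j - 1) := Nat.doubleFactorial_add_one (2 * j)
    rw [coeff_succ_ibpPoly_succ, coeff_eq_zero_of_natDegree_lt (by
      simpa [Nat.lt_succ_iff] using natDegree_ibpPoly_le j), ih, hdf]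
    simp only [mul_zero, derivative_zero, add_zero, zero_sub, Nat.cast_mul, Nat.cast_add,
      Nat.cast_ofNat, Nat.cast_one, C_mul, C_add, C_pow, C_neg, map_one, map_natCast, map_ofNat]
    ring

theorem exists_norm_ibpPoly_le (j : ℕ) :
    ∃ K : ℝ, 0 ≤ K ∧ ∀ (z u : ℂ) (B : ℝ), 1 / 2 ≤ ‖z‖ → 1 ≤ B → ‖u‖ ≤ B →
      ‖(ibpPoly j).evalEval z u‖ ≤ K * ‖z‖ ^ j * B ^ j :=
  exists_norm_evalEval_le _ (natDegree_coeff_ibpPoly_le j) (natDegree_ibpPoly_le j) one_half_pos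

theorem exists_norm_ibpPoly_le_leading (j : ℕ) :
    ∃ K : ℝ, 0 ≤ K ∧ ∀ (z u : ℂ) (B : ℝ), 1 / 2 ≤ ‖z‖ → 1 ≤ B → ‖u‖ ≤ B →
      ‖(ibpPoly j).evalEval z u‖
        ≤ ((Nat.doubleFactorial (2 * j - 1) : ℝ) + K * ‖z‖ ^ j * B⁻¹) * B ^ j := by
  cases j with
  | zero => exact ⟨0, le_rfl, fun z u B _ _ _ => by simp [ibpPoly]⟩
  | succ j =>
    have hX : ∀ l, (((ibpPoly (j + 1)).erase (j + 1)).coeff l).natDegree ≤ j + 1 := fun l => by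
      rw [coeff_erase]
      split_ifs
      exacts [by simp, natDegree_coeff_ibpPoly_le _ _]
    have hY : ((ibpPoly (j + 1)).erase (j + 1)).natDegree ≤ j := by
      refine natDegree_le_iff_coeff_eq_zero.2 fun l hl => ?_
      rw [coeff_erase]
      split_ifs with h
      exacts [rfl, natDegree_le_iff_coeff_eq_zero.1 (natDegree_ibpPoly_le _) l (by omega)]
    obtain ⟨K, hK0, hK⟩ := exists_norm_evalEval_le _ hX hY one_half_pos
    refine ⟨K, hK0, fun z u B hz hB hu => ?_⟩
    set D := Nat.doubleFactorial (2 * (j + 1) - 1)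
    have hlead : ‖(monomial (j + 1) ((ibpPoly (j + 1)).coeff (j + 1))).evalEval z u‖
        ≤ D * B ^ (j + 1) := by
      rw [coeff_self_ibpPoly, ← C_mul_X_pow_eq_monomial, evalEval_mul, evalEval_pow, evalEval_X,
        evalEval_C, eval_C, norm_mul, norm_mul, norm_pow, norm_pow, norm_neg, norm_one, one_pow,
        one_mul, Complex.norm_natCast]
      gcongr
    rw [← monomial_add_erase (ibpPoly (j + 1)) (j + 1), evalEval_add]
    calc _ ≤ D * B ^ (j + 1) + K * ‖z‖ ^ (j + 1) * B ^ j :=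
          norm_add_le_of_le hlead (hK z u B hz hB hu)
      _ = _ := by field_simp; ring

end Bivariate

/-- The plane cut along `(-∞,0]` and `[1,∞)`, where the phase `F` is holomorphic. -/
def cutPlane : Set ℂ := {z | z ∈ Complex.slitPlane ∧ 1 - z ∈ Complex.slitPlane}

theorem isOpen_cutPlane : IsOpen cutPlane :=
  Complex.isOpen_slitPlane.inter
    (Complex.isOpen_slitPlane.preimage (continuous_const.sub continuous_id))

theorem ne_zero_of_mem_cutPlane {z : ℂ} (hz : z ∈ cutPlane) : z ≠ 0 :=
  Complex.slitPlane_ne_zero hz.1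

theorem one_sub_ne_zero_of_mem_cutPlane {z : ℂ} (hz : z ∈ cutPlane) : 1 - z ≠ 0 :=
  Complex.slitPlane_ne_zero hz.2

theorem mem_cutPlane_of_im_pos {z : ℂ} (hz : 0 < z.im) : z ∈ cutPlane :=
  ⟨Or.inr hz.ne', Or.inr (by simpa using hz.ne')⟩

theorem ofReal_mem_cutPlane {x : ℝ} (h0 : 0 < x) (h1 : x < 1) : (x : ℂ) ∈ cutPlane :=
  ⟨Or.inl (by simpa using h0), Or.inl (by simpa using h1)⟩

theorem hasDerivAt_one_sub (z : ℂ) : HasDerivAt (fun w : ℂ => 1 - w) (-1) z :=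
  (hasDerivAt_id z).const_sub 1

theorem hasDerivAt_log_one_sub {z : ℂ} (hz : z ∈ cutPlane) :
    HasDerivAt (fun w => Complex.log (1 - w)) (-(1 - z)⁻¹) z := by
  simpa [div_eq_mul_inv] using (hasDerivAt_one_sub z).clog hz.2

theorem hasDerivAt_F_log {z : ℂ} (hz : z ∈ cutPlane) (lam : ℝ) :
    HasDerivAt (fun w => F w lam)
      (Complex.log z - Complex.log (1 - z) + (Real.log lam : ℂ)) z := by
  have h0 := ne_zero_of_mem_cutPlane hz
  have h1 := one_sub_ne_zero_of_mem_cutPlane hz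
  refine ((((hasDerivAt_one_sub z).mul (hasDerivAt_log_one_sub hz)).add
    ((hasDerivAt_id z).mul (Complex.hasDerivAt_log hz.1))).add
    ((hasDerivAt_id z).mul_const (Real.log lam : ℂ))).congr_deriv ?_
  simp only [id]
  field_simp
  ring

theorem dF_eq {z : ℂ} (hz : z ∈ cutPlane) (lam : ℝ) :
    dF lam z = Complex.log z - Complex.log (1 - z) + (Real.log lam : ℂ) :=
  (hasDerivAt_F_log hz lam).deriv

theorem hasDerivAt_F {z : ℂ} (hz : z ∈ cutPlane) (lam : ℝ) :
    HasDerivAt (fun w => F w lam) (dF lam z) z :=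
  (hasDerivAt_F_log hz lam).differentiableAt.hasDerivAt

theorem hasDerivAt_exp_phase {z : ℂ} (hz : z ∈ cutPlane) (t lam : ℝ) :
    HasDerivAt (fun w => Complex.exp (Complex.I * t * F w lam))
      (Complex.I * t * dF lam z * Complex.exp (Complex.I * t * F z lam)) z :=
  ((hasDerivAt_F hz lam).const_mul (Complex.I * (t : ℂ))).cexp.congr_deriv (mul_comm _ _)

theorem hasDerivAt_dF {z : ℂ} (hz : z ∈ cutPlane) (lam : ℝ) :
    HasDerivAt (dF lam) (z * (1 - z))⁻¹ z := by
  have h0 := ne_zero_of_mem_cutPlane hz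
  have h1 := one_sub_ne_zero_of_mem_cutPlane hz
  have h : HasDerivAt (dF lam) (z⁻¹ - -(1 - z)⁻¹) z :=
    (((Complex.hasDerivAt_log hz.1).sub (hasDerivAt_log_one_sub hz)).add_const
      (Real.log lam : ℂ)).congr_of_eventuallyEq
      (eventuallyEq_of_mem (isOpen_cutPlane.mem_nhds hz) fun w hw => dF_eq hw lam)
  refine h.congr_deriv ?_
  field_simp
  ring

/-- The cut plane without the stationary points of the phase, where one can integrate by parts. -/
def regularSet (lam : ℝ) : Set ℂ := {z | z ∈ cutPlane ∧ dF lam z ≠ 0}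

theorem regularSet_mem_nhds {lam : ℝ} {z : ℂ} (hz : z ∈ regularSet lam) :
    regularSet lam ∈ nhds z :=
  inter_mem (isOpen_cutPlane.mem_nhds hz.1)
    ((hasDerivAt_dF hz.1 lam).continuousAt.eventually_ne hz.2)

theorem hasDerivAt_inv_dF {lam : ℝ} {z : ℂ} (hz : z ∈ regularSet lam) :
    HasDerivAt (fun w => (dF lam w)⁻¹) (-(z * (1 - z))⁻¹ * (dF lam z)⁻¹ ^ 2) z := by
  refine ((hasDerivAt_dF hz.1 lam).inv hz.2).congr_deriv ?_
  rw [div_eq_mul_inv, inv_pow]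

theorem hasDerivAt_one_sub_cpow {z : ℂ} (hz : z ∈ cutPlane) :
    HasDerivAt (fun w : ℂ => (1 - w) ^ (-(1 / 2) : ℂ))
      (1 / 2 * (1 - z)⁻¹ * (1 - z) ^ (-(1 / 2) : ℂ)) z := by
  have h1 := one_sub_ne_zero_of_mem_cutPlane hz
  refine ((hasDerivAt_one_sub z).cpow_const (c := (-(1 / 2) : ℂ)) hz.2).congr_deriv ?_
  rw [Complex.cpow_sub _ _ h1, Complex.cpow_one]
  field_simp

theorem norm_one_sub_cpow_neg_half (z : ℂ) :
    ‖(1 - z) ^ (-(1 / 2) : ℂ)‖ = ‖1 - z‖ ^ (-(1 / 2) : ℝ) := by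
  rw [show (-(1 / 2) : ℂ) = ((-(1 / 2) : ℝ) : ℂ) by push_cast; rfl, Complex.norm_cpow_real]

theorem hasDerivAt_inv_mul_one_sub_pow {z : ℂ} (hz : z ∈ cutPlane) (j : ℕ) :
    HasDerivAt (fun w : ℂ => (w * (1 - w))⁻¹ ^ j)
      (-(j : ℂ) * (z * (1 - z))⁻¹ ^ (j + 1) * (1 - 2 * z)) z := by
  have hz0 : z * (1 - z) ≠ 0 :=
    mul_ne_zero (ne_zero_of_mem_cutPlane hz) (one_sub_ne_zero_of_mem_cutPlane hz)
  refine ((((hasDerivAt_id z).mul (hasDerivAt_one_sub z)).inv hz0).pow j).congr_deriv ?_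
  cases j with
  | zero => simp
  | succ j =>
    simp only [id, Pi.mul_apply, Pi.inv_apply, Nat.add_sub_cancel, div_eq_mul_inv, ← inv_pow]
    ring

/-- The iterates of `ibpOp` on `ibpStart` in closed form, up to the constant
`(-1)^j (it)^(-j-1)`. -/
noncomputable def ibpClosed (lam : ℝ) (j : ℕ) (z : ℂ) : ℂ :=
  (1 - z) ^ (-(1 / 2) : ℂ) * (z * (1 - z))⁻¹ ^ j * (dF lam z)⁻¹ ^ (j + 1)
    * (ibpPoly j).evalEval z (dF lam z)⁻¹

open Polynomial in
theorem evalEval_ibpPoly_succ (j : ℕ) (z u : ℂ) :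
    (ibpPoly (j + 1)).evalEval z u
      = (z / 2 - j * (1 - 2 * z)) * (ibpPoly j).evalEval z u
        + z * (1 - z) * (derivativeX (ibpPoly j)).evalEval z u
        - u * ((j + 1) * (ibpPoly j).evalEval z u
          + u * (derivative (ibpPoly j)).evalEval z u) := by
  rw [ibpPoly]
  simp only [evalEval_sub, evalEval_add, evalEval_mul, evalEval_C, evalEval_X, evalEval_natCast,
    evalEval_one, eval_sub, eval_mul, eval_C, eval_X, eval_one, eval_ofNat]
  ring

theorem hasDerivAt_ibpClosed {lam : ℝ} {z : ℂ} (hz : z ∈ regularSet lam) (j : ℕ) :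
    HasDerivAt (ibpClosed lam j) (dF lam z * ibpClosed lam (j + 1) z) z := by
  have h0 := ne_zero_of_mem_cutPlane hz.1
  have h1 := one_sub_ne_zero_of_mem_cutPlane hz.1
  have hu := hasDerivAt_inv_dF hz
  refine ((((hasDerivAt_one_sub_cpow hz.1).mul (hasDerivAt_inv_mul_one_sub_pow hz.1 j)).mul
    (hu.pow (j + 1))).mul (hasDerivAt_evalEval (ibpPoly j) hu)).congr_deriv ?_
  simp only [Pi.mul_apply, Pi.pow_apply, ibpClosed, evalEval_ibpPoly_succ, Nat.add_sub_cancel]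
  have hw : dF lam z * (dF lam z)⁻¹ ^ (j + 1 + 1) = (dF lam z)⁻¹ ^ (j + 1) := by
    rw [pow_succ' _ (j + 1), mul_inv_cancel_left₀ hz.2]
  have hi : (1 - z)⁻¹ = z * (z * (1 - z))⁻¹ := by field_simp
  have hq : z * (1 - z) * (z * (1 - z))⁻¹ ^ (j + 1) = (z * (1 - z))⁻¹ ^ j := by
    rw [pow_succ', mul_inv_cancel_left₀ (mul_ne_zero h0 h1)]
  rw [hi]
  clear hu
  generalize (z * (1 - z))⁻¹ = q at *
  generalize (dF lam z)⁻¹ = u at *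
  generalize (1 - z) ^ (-(1 / 2) : ℂ) = A
  push_cast
  linear_combination -(A * u ^ (j + 1) * (derivativeX (ibpPoly j)).evalEval z u) * hq
    - A * q ^ (j + 1) * ((z / 2 - j * (1 - 2 * z)) * (ibpPoly j).evalEval z u
        + z * (1 - z) * (derivativeX (ibpPoly j)).evalEval z u
        - u * ((j + 1) * (ibpPoly j).evalEval z u
          + u * (Polynomial.derivative (ibpPoly j)).evalEval z u)) * hw

theorem iterate_ibpOp_eq {t lam : ℝ} (j : ℕ) {z : ℂ} (hz : z ∈ regularSet lam) :
    (ibpOp t lam)^[j] (ibpStart t lam) z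
      = (-1) ^ j * ((Complex.I * t)⁻¹) ^ (j + 1) * ibpClosed lam j z := by
  induction j generalizing z with
  | zero =>
    simp only [Function.iterate_zero, id, ibpStart, ibpClosed, ibpPoly, Polynomial.evalEval_one,
      pow_zero, zero_add, pow_one, mul_one, one_mul, div_eq_mul_inv, mul_inv_rev, Complex.inv_I]
    ring
  | succ j ih =>
    rw [Function.iterate_succ_apply', ibpOp,
      (eventuallyEq_of_mem (regularSet_mem_nhds hz) fun w hw => ih hw).deriv_eq,
      ((hasDerivAt_ibpClosed hz j).const_mul _).deriv, div_eq_mul_inv, mul_inv]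
    linear_combination (-(-1) ^ j * (Complex.I * (t : ℂ))⁻¹ ^ (j + 2) * ibpClosed lam (j + 1) z)
      * inv_mul_cancel₀ hz.2

theorem norm_iterate_ibpOp {t lam : ℝ} (ht : 0 < t) (j : ℕ) {z : ℂ} (hz : z ∈ regularSet lam) :
    ‖(ibpOp t lam)^[j] (ibpStart t lam) z‖ = t⁻¹ ^ (j + 1) * ‖ibpClosed lam j z‖ := by
  rw [iterate_ibpOp_eq j hz]
  simp [abs_of_pos ht]

theorem hasDerivAt_iterate_ibpOp {t lam : ℝ} (ht : t ≠ 0) (j : ℕ) {z : ℂ}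
    (hz : z ∈ regularSet lam) :
    HasDerivAt ((ibpOp t lam)^[j] (ibpStart t lam))
      (-(Complex.I * t * dF lam z) * (ibpOp t lam)^[j + 1] (ibpStart t lam) z) z := by
  have hIt : Complex.I * (t : ℂ) ≠ 0 := by simpa using ht
  refine (((hasDerivAt_ibpClosed hz j).const_mul
    ((-1) ^ j * ((Complex.I * t)⁻¹) ^ (j + 1))).congr_of_eventuallyEq
    (eventuallyEq_of_mem (regularSet_mem_nhds hz)
      fun w hw => iterate_ibpOp_eq j hw)).congr_deriv ?_
  rw [iterate_ibpOp_eq (j + 1) hz]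
  linear_combination (-((-1) ^ j * (Complex.I * (t : ℂ))⁻¹ ^ (j + 1) * dF lam z
    * ibpClosed lam (j + 1) z)) * mul_inv_cancel₀ hIt

theorem hasDerivAt_sum_ibp {t lam : ℝ} (ht : t ≠ 0) (N : ℕ) {z : ℂ} (hz : z ∈ regularSet lam) :
    HasDerivAt (fun w => (∑ j ∈ Finset.range N, (ibpOp t lam)^[j] (ibpStart t lam) w)
        * Complex.exp (Complex.I * t * F w lam))
      ((1 - z) ^ (-(1 / 2) : ℂ) * Complex.exp (Complex.I * t * F z lam)
        - (ibpOp t lam)^[N] (ibpStart t lam) z * (Complex.I * t * dF lam z)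
          * Complex.exp (Complex.I * t * F z lam)) z := by
  have hIt : Complex.I * (t : ℂ) ≠ 0 := by simpa using ht
  refine ((HasDerivAt.fun_sum fun j (_ : j ∈ Finset.range N) =>
    hasDerivAt_iterate_ibpOp ht j hz).mul (hasDerivAt_exp_phase hz.1 t lam)).congr_deriv ?_
  have hstart : (1 - z) ^ (-(1 / 2) : ℂ) = ibpStart t lam z * (Complex.I * t * dF lam z) := by
    rw [ibpStart, div_mul_cancel₀ _ (mul_ne_zero hIt hz.2)]
  have htel := Finset.sum_range_sub' (fun j => (ibpOp t lam)^[j] (ibpStart t lam) z) N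
  rw [Finset.sum_sub_distrib, Function.iterate_zero, id] at htel
  rw [hstart, ← Finset.mul_sum]
  linear_combination (Complex.I * t * dF lam z * Complex.exp (Complex.I * t * F z lam)) * htel

theorem norm_ibpClosed (lam : ℝ) (j : ℕ) (z : ℂ) :
    ‖ibpClosed lam j z‖ = ‖1 - z‖ ^ (-(1 / 2) : ℝ) * ‖1 - z‖⁻¹ ^ j * ‖dF lam z‖⁻¹ ^ (j + 1)
      * (‖z‖⁻¹ ^ j * ‖(ibpPoly j).evalEval z (dF lam z)⁻¹‖) := by
  rw [ibpClosed, norm_mul, norm_mul, norm_mul, norm_one_sub_cpow_neg_half, norm_pow, norm_pow,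
    norm_inv, norm_inv, norm_mul, mul_inv, mul_pow]
  ring

/-- The order of magnitude of the `j`-th integrated-by-parts amplitude, up to the factor
`t^(-j-1)`, at a point with `‖1 - z‖` of size `x` and `‖∂F/∂z‖` of size `b`. -/
noncomputable def ibpScale (x b : ℝ) (j : ℕ) : ℝ :=
  x ^ (-(1 / 2) : ℝ) * x⁻¹ ^ j * b⁻¹ ^ (2 * j + 1)

theorem ibpScale_nonneg {x b : ℝ} (hx : 0 ≤ x) (hb : 0 ≤ b) (j : ℕ) : 0 ≤ ibpScale x b j := by
  rw [ibpScale]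
  positivity

theorem ibpScale_anti {x y b : ℝ} (hx : 0 < x) (hxy : x ≤ y) (hb : 0 ≤ b) (j : ℕ) :
    ibpScale y b j ≤ ibpScale x b j := by
  have : 0 < y := hx.trans_le hxy
  rw [ibpScale, ibpScale]
  gcongr ?_ * ?_ ^ j * _
  · exact Real.rpow_le_rpow_of_nonpos hx hxy (by norm_num)
  · exact inv_anti₀ hx hxy

theorem ibpScale_mul {x c : ℝ} (hx : 0 ≤ x) (hc : 0 ≤ c) (b : ℝ) (j : ℕ) :
    ibpScale (x * c) b j = ibpScale x b j * (c ^ (-(1 / 2) : ℝ) * c⁻¹ ^ j) := by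
  rw [ibpScale, ibpScale, Real.mul_rpow hx hc, mul_inv, mul_pow]
  ring

theorem exists_norm_ibpClosed_le (j : ℕ) : ∃ K : ℝ, 0 ≤ K ∧ ∀ (lam b : ℝ) (z : ℂ),
    1 / 2 ≤ ‖z‖ → 0 < b → b ≤ 1 → b ≤ ‖dF lam z‖ →
    ‖ibpClosed lam j z‖ * (1 + ‖dF lam z‖) ≤ K * ibpScale ‖1 - z‖ b j := by
  obtain ⟨K, hK0, hK⟩ := exists_norm_ibpPoly_le j
  refine ⟨2 * K, by positivity, fun lam b z hz hb hb1 hbw => ?_⟩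
  have : 0 < ‖z‖ := one_half_pos.trans_le hz
  have hw : 0 < ‖dF lam z‖ := hb.trans_le hbw
  have hB : 1 ≤ b⁻¹ := (one_le_inv₀ hb).2 hb1
  have hu : ‖dF lam z‖⁻¹ ≤ b⁻¹ := inv_anti₀ hb hbw
  have hP : ‖z‖⁻¹ ^ j * ‖(ibpPoly j).evalEval z (dF lam z)⁻¹‖ ≤ K * b⁻¹ ^ j := by
    rw [inv_pow, inv_mul_le_iff₀ (by positivity)]
    exact (hK z _ _ hz hB (by rwa [norm_inv])).trans_eq (by ring)
  have hU : ‖dF lam z‖⁻¹ ^ (j + 1) * (1 + ‖dF lam z‖) ≤ 2 * b⁻¹ ^ (j + 1) := by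
    calc _ = ‖dF lam z‖⁻¹ ^ j * (‖dF lam z‖⁻¹ + 1) := by
          rw [pow_succ, mul_assoc, mul_add, mul_one, inv_mul_cancel₀ hw.ne']
      _ ≤ b⁻¹ ^ j * (b⁻¹ + b⁻¹) := by gcongr
      _ = _ := by ring
  calc _ = ‖1 - z‖ ^ (-(1 / 2) : ℝ) * ‖1 - z‖⁻¹ ^ j
        * ((‖dF lam z‖⁻¹ ^ (j + 1) * (1 + ‖dF lam z‖))
          * (‖z‖⁻¹ ^ j * ‖(ibpPoly j).evalEval z (dF lam z)⁻¹‖)) := by rw [norm_ibpClosed]; ring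
    _ ≤ ‖1 - z‖ ^ (-(1 / 2) : ℝ) * ‖1 - z‖⁻¹ ^ j * ((2 * b⁻¹ ^ (j + 1)) * (K * b⁻¹ ^ j)) := by
        gcongr
    _ = _ := by rw [ibpScale]; ring

theorem exists_norm_ibpClosed_le_leading (j : ℕ) : ∃ K : ℝ, 0 ≤ K ∧ ∀ (lam b : ℝ) (z : ℂ),
    1 / 2 ≤ ‖z‖ → 0 < b → b ≤ 1 → b ≤ ‖dF lam z‖ →
    ‖ibpClosed lam j z‖ ≤ ibpScale ‖1 - z‖ b j
      * (‖z‖⁻¹ ^ j * (Nat.doubleFactorial (2 * j - 1) : ℝ) + K * b) := by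
  obtain ⟨K, hK0, hK⟩ := exists_norm_ibpPoly_le_leading j
  refine ⟨K, hK0, fun lam b z hz hb hb1 hbw => ?_⟩
  have : 0 < ‖z‖ := one_half_pos.trans_le hz
  have hB : 1 ≤ b⁻¹ := (one_le_inv₀ hb).2 hb1
  have hu : ‖dF lam z‖⁻¹ ≤ b⁻¹ := inv_anti₀ hb hbw
  set D : ℝ := (Nat.doubleFactorial (2 * j - 1) : ℝ)
  have hP : ‖z‖⁻¹ ^ j * ‖(ibpPoly j).evalEval z (dF lam z)⁻¹‖
      ≤ (‖z‖⁻¹ ^ j * D + K * b) * b⁻¹ ^ j := by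
    calc _ ≤ ‖z‖⁻¹ ^ j * ((D + K * ‖z‖ ^ j * b⁻¹⁻¹) * b⁻¹ ^ j) := by
          gcongr
          exact hK z _ _ hz hB (by rwa [norm_inv])
      _ = _ := by rw [inv_inv, inv_pow]; field_simp
  calc _ ≤ ‖1 - z‖ ^ (-(1 / 2) : ℝ) * ‖1 - z‖⁻¹ ^ j * b⁻¹ ^ (j + 1)
        * ((‖z‖⁻¹ ^ j * D + K * b) * b⁻¹ ^ j) := by
        rw [norm_ibpClosed]
        gcongr
    _ = _ := by rw [ibpScale]; ring

section Phase

theorem norm_exp_phase (t : ℝ) (w : ℂ) :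
    ‖Complex.exp (Complex.I * t * w)‖ = Real.exp (-(t * w.im)) := by
  simp [Complex.norm_exp]

theorem log_neg_of_im_pos {z : ℂ} (hz : 0 < z.im) :
    Complex.log (-z) = Complex.log z - Real.pi * Complex.I := by
  rw [Complex.log, Complex.log, Complex.arg_neg_eq_arg_sub_pi_of_im_pos hz, norm_neg]
  push_cast
  ring

theorem monotone_im_mul_log {z : ℂ} (hz : 0 < z.im) :
    Monotone fun s : ℝ => ((z + s) * Complex.log (z + s)).im := by
  have him (s : ℝ) : 0 < (z + s).im := by simpa using hz
  have hderiv (s : ℝ) : HasDerivAt (fun s : ℝ => ((z + s) * Complex.log (z + s)).im)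
      (Complex.arg (z + s)) s := by
    have h1 : HasDerivAt (fun s : ℝ => z + (s : ℂ)) 1 s :=
      (Complex.ofRealCLM.hasDerivAt (x := s)).const_add z
    have h2 := h1.mul (h1.clog_real (Or.inr (him s).ne'))
    refine (Complex.imCLM.hasFDerivAt.comp_hasDerivAt s h2).congr_deriv ?_
    have hne : z + (s : ℂ) ≠ 0 := ne_zero_of_mem_cutPlane (mem_cutPlane_of_im_pos (him s))
    rw [mul_one_div_cancel hne]
    simp [Complex.log_im]
  refine monotone_of_deriv_nonneg (fun s => (hderiv s).differentiableAt) fun s => ?_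
  rw [(hderiv s).deriv]
  exact Complex.arg_nonneg_iff.2 (him s).le

/-- The linear lower bound for the imaginary part of the phase far from the cuts: in the direction
`v` the integrand decays like `exp (-t * decayRate lam v * R)`. -/
noncomputable def decayRate (lam : ℝ) (v : ℂ) : ℝ := Real.pi * v.re + v.im * Real.log lam

theorem decayRate_sub_one_le_im_F {z : ℂ} (hz : 0 < z.im) (lam : ℝ) :
    decayRate lam (z - 1) ≤ (F z lam).im := by
  have hz' : 0 < (z - 1).im := by simpa using hz
  have hmono := monotone_im_mul_log hz' (zero_le_one' ℝ)
  simp only [Complex.ofReal_zero, add_zero, Complex.ofReal_one, sub_add_cancel] at hmono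
  have hlog : Complex.log (1 - z) = Complex.log (z - 1) - Real.pi * Complex.I := by
    rw [← log_neg_of_im_pos hz', neg_sub]
  have hF : F z lam = z * Complex.log z - (z - 1) * Complex.log (z - 1)
      + Real.pi * (z - 1) * Complex.I + z * (Real.log lam : ℂ) := by
    rw [F, hlog]; ring
  have hlinear : ((Real.pi : ℂ) * (z - 1) * Complex.I + z * (Real.log lam : ℂ)).im
      = decayRate lam (z - 1) := by simp [decayRate]
  rw [hF, add_assoc, Complex.add_im, Complex.sub_im, hlinear]
  linarith

theorem dF_re {z : ℂ} (hz : z ∈ cutPlane) (lam : ℝ) :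
    (dF lam z).re = Real.log ‖z‖ - Real.log ‖1 - z‖ + Real.log lam := by
  simp [dF_eq hz, Complex.log_re]

theorem dF_im {z : ℂ} (hz : z ∈ cutPlane) (lam : ℝ) :
    (dF lam z).im = Complex.arg z - Complex.arg (1 - z) := by
  simp [dF_eq hz, Complex.log_im]

theorem im_dF_nonneg {z : ℂ} (hz : z ∈ cutPlane) (him : 0 ≤ z.im) (lam : ℝ) :
    0 ≤ (dF lam z).im := by
  rw [dF_im hz, sub_nonneg]
  refine le_trans ?_ (Complex.arg_nonneg_iff.2 him)
  rcases him.eq_or_lt with h | h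
  · have hre : 0 ≤ (1 - z).re :=
      (hz.2.resolve_right fun h' => h' (by simp [← h])).le
    exact (Complex.arg_eq_zero_iff.2 ⟨hre, by simp [← h]⟩).le
  · exact (Complex.arg_neg_iff.2 (by simpa using h)).le

theorem pi_div_two_le_im_dF {z : ℂ} (hre : 1 ≤ z.re) (him : 0 < z.im) (lam : ℝ) :
    Real.pi / 2 ≤ (dF lam z).im := by
  rw [dF_im (mem_cutPlane_of_im_pos him)]
  have hz := Complex.arg_nonneg_iff.2 him.le
  have hneg : Complex.arg (1 - z) < 0 := Complex.arg_neg_iff.2 (by simpa using him)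
  have habs : ¬ |Complex.arg (1 - z)| < Real.pi / 2 := by
    rw [Complex.abs_arg_lt_pi_div_two_iff]
    rintro (h | h)
    · exact absurd h (by simpa using hre)
    · simp [h] at hneg
  rw [abs_of_neg hneg] at habs
  linarith

theorem le_re_dF {z : ℂ} (hz : z ∈ cutPlane) {k : ℝ} (hk : k < 1) (hre : 1 - k ≤ z.re)
    (hnorm : ‖1 - z‖ ≤ k) (lam : ℝ) :
    Real.log (1 - k) - Real.log k + Real.log lam ≤ (dF lam z).re := by
  rw [dF_re hz]
  have h1 := Real.log_le_log (sub_pos.2 hk) (hre.trans (Complex.re_le_norm z))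
  have h2 := Real.log_le_log (norm_pos_iff.2 (one_sub_ne_zero_of_mem_cutPlane hz)) hnorm
  linarith

theorem log_le_re_dF {z : ℂ} (hz : z ∈ cutPlane) (hre : 1 / 2 ≤ z.re) (lam : ℝ) :
    Real.log lam ≤ (dF lam z).re := by
  rw [dF_re hz]
  have hnorm : ‖1 - z‖ ≤ ‖z‖ := by
    rw [← sq_le_sq₀ (norm_nonneg _) (norm_nonneg _), Complex.sq_norm, Complex.sq_norm,
      Complex.normSq_apply, Complex.normSq_apply]
    simp only [Complex.sub_re, Complex.sub_im, Complex.one_re, Complex.one_im]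
    linarith
  have := Real.log_le_log (norm_pos_iff.2 (one_sub_ne_zero_of_mem_cutPlane hz)) hnorm
  linarith

/-- The point at parameter `R` on the ray from `x` in the direction `v`. -/
def ray (x : ℝ) (v : ℂ) (R : ℝ) : ℂ := x + R * v

theorem ray_re (x : ℝ) (v : ℂ) (R : ℝ) : (ray x v R).re = x + R * v.re := by simp [ray]

theorem ray_im (x : ℝ) (v : ℂ) (R : ℝ) : (ray x v R).im = R * v.im := by simp [ray]

theorem ray_zero (x : ℝ) (v : ℂ) : ray x v 0 = x := by simp [ray]

theorem hasDerivAt_ray (x : ℝ) (v : ℂ) (R : ℝ) : HasDerivAt (ray x v) v R :=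
  (((Complex.ofRealCLM.hasDerivAt (x := R)).mul_const v).const_add (x : ℂ)).congr_deriv
    (one_mul v)

theorem ray_mem_cutPlane {x : ℝ} {v : ℂ} (hx0 : 0 < x) (hx1 : x < 1) (hv : 0 < v.im) {R : ℝ}
    (hR : 0 ≤ R) : ray x v R ∈ cutPlane := by
  rcases hR.eq_or_lt with rfl | hR
  · simpa only [ray_zero] using ofReal_mem_cutPlane hx0 hx1
  · exact mem_cutPlane_of_im_pos (by rw [ray_im]; positivity)

end Phase

section SlantRay

/-- The ray from `1 - k` in the direction `1 + iη`, along which the integral beyond the splitting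
point is estimated. -/
def slantRay (k η R : ℝ) : ℂ := ray (1 - k) (1 + η * Complex.I) R

theorem slantRay_re (k η R : ℝ) : (slantRay k η R).re = 1 - k + R := by simp [slantRay, ray_re]

theorem slantRay_im (k η R : ℝ) : (slantRay k η R).im = R * η := by simp [slantRay, ray_im]

theorem slantRay_zero (k η : ℝ) : slantRay k η 0 = 1 - k := by simp [slantRay, ray_zero]

variable {k η lam R : ℝ}

theorem slantRay_mem_cutPlane (hk0 : 0 < k) (hk1 : k < 1) (hη : 0 < η) (hR : 0 ≤ R) :
    slantRay k η R ∈ cutPlane :=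
  ray_mem_cutPlane (sub_pos.2 hk1) (sub_lt_self 1 hk0) (by simpa using hη) hR

theorem half_le_norm_slantRay (hk : k ≤ 1 / 2) (hR : 0 ≤ R) : 1 / 2 ≤ ‖slantRay k η R‖ := by
  have := Complex.re_le_norm (slantRay k η R)
  rw [slantRay_re] at this
  linarith

theorem le_norm_one_sub_slantRay (hk0 : 0 < k) (hη : 0 < η) (hη1 : η ≤ 1) (R : ℝ) :
    η * k / 2 ≤ ‖1 - slantRay k η R‖ := by
  rcases le_total R (k / 2) with h | h
  · have := Complex.re_le_norm (1 - slantRay k η R)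
    rw [Complex.sub_re, slantRay_re, Complex.one_re] at this
    nlinarith
  · have := Complex.abs_im_le_norm (1 - slantRay k η R)
    rw [Complex.sub_im, slantRay_im, Complex.one_im, zero_sub, abs_neg] at this
    nlinarith [le_abs_self (R * η)]

theorem norm_one_sub_slantRay_le (hη : |η| ≤ 1) (hR0 : 0 ≤ R) (hR : R ≤ k) :
    ‖1 - slantRay k η R‖ ≤ k := by
  rw [← sq_le_sq₀ (norm_nonneg _) (hR0.trans hR), Complex.sq_norm, Complex.normSq_apply,
    Complex.sub_re, Complex.sub_im, slantRay_re, slantRay_im, Complex.one_re, Complex.one_im]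
  have hη2 : η ^ 2 ≤ 1 := (sq_le_one_iff_abs_le_one η).2 hη
  nlinarith [mul_nonneg hR0 (sub_nonneg.2 hR), mul_le_of_le_one_right (sq_nonneg R) hη2]

theorem le_re_dF_slantRay (hk0 : 0 < k) (hk1 : k < 1) (hη : 0 < η) (hη1 : η ≤ 1)
    (hR0 : 0 ≤ R) (hR : R ≤ k) :
    Real.log (1 - k) - Real.log k + Real.log lam ≤ (dF lam (slantRay k η R)).re :=
  le_re_dF (slantRay_mem_cutPlane hk0 hk1 hη hR0) hk1 (by rw [slantRay_re]; linarith)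
    (norm_one_sub_slantRay_le (by rwa [abs_of_pos hη]) hR0 hR) lam

theorem pi_div_two_le_im_dF_slantRay (hk0 : 0 < k) (hη : 0 < η) (hR : k ≤ R) :
    Real.pi / 2 ≤ (dF lam (slantRay k η R)).im :=
  pi_div_two_le_im_dF (by rw [slantRay_re]; linarith)
    (by rw [slantRay_im]; exact mul_pos (hk0.trans_le hR) hη) lam

theorem le_norm_dF_slantRay (hk0 : 0 < k) (hk1 : k < 1) (hη : 0 < η) (hη1 : η ≤ 1) {b : ℝ}
    (hb1 : b ≤ 1) (hb : b ≤ Real.log (1 - k) - Real.log k + Real.log lam) (hR : 0 ≤ R) :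
    b ≤ ‖dF lam (slantRay k η R)‖ := by
  rcases le_total R k with h | h
  · exact hb.trans ((le_re_dF_slantRay hk0 hk1 hη hη1 hR h).trans (Complex.re_le_norm _))
  · have h1 := pi_div_two_le_im_dF_slantRay (lam := lam) hk0 hη h
    have h2 := (le_abs_self _).trans (Complex.abs_im_le_norm (dF lam (slantRay k η R)))
    linarith [Real.pi_gt_three]

theorem hasDerivAt_im_F_slantRay (hk0 : 0 < k) (hk1 : k < 1) (hη : 0 < η) (hR : 0 ≤ R) :
    HasDerivAt (fun R => (F (slantRay k η R) lam).im)
      ((dF lam (slantRay k η R)).im + η * (dF lam (slantRay k η R)).re) R := by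
  have h := (hasDerivAt_F (slantRay_mem_cutPlane hk0 hk1 hη hR) lam).comp R
    (hasDerivAt_ray (1 - k) (1 + η * Complex.I) R)
  refine (Complex.imCLM.hasFDerivAt.comp_hasDerivAt R h).congr_deriv ?_
  simp only [Complex.imCLM_apply, Complex.mul_im, Complex.add_im, Complex.one_im,
    Complex.ofReal_re, Complex.I_im, mul_one, Complex.ofReal_im, Complex.I_re, mul_zero, add_zero,
    zero_add, Complex.add_re, Complex.one_re, Complex.mul_re, sub_self]
  ring

theorem monotoneOn_of_hasDerivAt_nonneg {D : Set ℝ} (hD : Convex ℝ D) {f f' : ℝ → ℝ}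
    (hf : ∀ x ∈ D, HasDerivAt f (f' x) x) (hf' : ∀ x ∈ D, 0 ≤ f' x) : MonotoneOn f D :=
  monotoneOn_of_hasDerivWithinAt_nonneg hD
    (fun x hx => (hf x hx).continuousAt.continuousWithinAt)
    (fun x hx => (hf x (interior_subset hx)).hasDerivWithinAt)
    fun x hx => hf' x (interior_subset hx)

theorem im_F_slantRay_nonneg (hk0 : 0 < k) (hk1 : k < 1) (hη : 0 < η) (hη1 : η ≤ 1)
    (hb : 0 ≤ Real.log (1 - k) - Real.log k + Real.log lam) (hR0 : 0 ≤ R) (hR : R ≤ k) :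
    0 ≤ (F (slantRay k η R) lam).im := by
  have hmono : MonotoneOn (fun R => (F (slantRay k η R) lam).im) (Set.Icc 0 k) := by
    refine monotoneOn_of_hasDerivAt_nonneg (convex_Icc 0 k)
      (fun x hx => hasDerivAt_im_F_slantRay hk0 hk1 hη hx.1) fun x hx => ?_
    have him := im_dF_nonneg (slantRay_mem_cutPlane hk0 hk1 hη hx.1)
      (by rw [slantRay_im]; exact mul_nonneg hx.1 hη.le) lam
    have hre := hb.trans (le_re_dF_slantRay hk0 hk1 hη hη1 hx.1 hx.2)
    positivity
  have h0 := hmono ⟨le_rfl, hk0.le⟩ ⟨hR0, hR⟩ hR0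
  have hreal : (F (1 - (k : ℂ)) lam).im = 0 := by
    have h1k : (1 : ℂ) - (1 - k) = ((k : ℝ) : ℂ) := by ring
    rw [F, h1k, ← Complex.ofReal_one, ← Complex.ofReal_sub, ← Complex.ofReal_log hk0.le,
      ← Complex.ofReal_log (sub_nonneg.2 hk1.le)]
    simp
  simpa only [slantRay_zero, hreal] using h0

theorem le_im_F_slantRay (hk0 : 0 < k) (hk1 : k ≤ 1 / 2) (hη : 0 < η) (hη1 : η ≤ 1)
    (hlam : -1 ≤ η * Real.log lam)
    (hb : 0 ≤ Real.log (1 - k) - Real.log k + Real.log lam) (hR : k ≤ R) :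
    (R - k) / 2 ≤ (F (slantRay k η R) lam).im := by
  have hk1' : k < 1 := by linarith
  have hmono : MonotoneOn (fun R => (F (slantRay k η R) lam).im - R / 2) (Set.Ici k) := by
    refine monotoneOn_of_hasDerivAt_nonneg (convex_Ici k) (fun x (hx : k ≤ x) =>
      (hasDerivAt_im_F_slantRay hk0 hk1' hη (hk0.le.trans hx)).sub
        ((hasDerivAt_id x).div_const 2)) fun x (hx : k ≤ x) => ?_
    have him := pi_div_two_le_im_dF_slantRay (lam := lam) hk0 hη hx
    have hre := log_le_re_dF (slantRay_mem_cutPlane hk0 hk1' hη (hk0.le.trans hx))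
      (by rw [slantRay_re]; linarith) lam
    linarith [mul_le_mul_of_nonneg_left hre hη.le, Real.pi_gt_three]
  have h1 := hmono Set.self_mem_Ici hR hR
  have h2 := im_F_slantRay_nonneg hk0 hk1' hη hη1 hb hk0.le le_rfl
  simp only at h1
  linarith

theorem sq_one_add_le_exp {s : ℝ} (hs : 0 ≤ s) : (1 + s) ^ 2 ≤ Real.exp (2 * s) := by
  rw [two_mul, Real.exp_add, ← sq, add_comm]
  exact pow_le_pow_left₀ (by positivity) (Real.add_one_le_exp s) 2

theorem norm_exp_phase_slantRay_le (hk0 : 0 < k) (hk1 : k ≤ 1 / 2) (hη : 0 < η) (hη1 : η ≤ 1)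
    (hlam : -1 ≤ η * Real.log lam)
    (hb : 0 ≤ Real.log (1 - k) - Real.log k + Real.log lam) {t : ℝ} (ht : 2 ≤ t) (hR : 0 ≤ R) :
    ‖Complex.exp (Complex.I * t * F (slantRay k η R) lam)‖ ≤ 4 / (1 + R) ^ 2 := by
  rw [norm_exp_phase, le_div_iff₀ (by positivity)]
  rcases le_total R k with h | h
  · have him := im_F_slantRay_nonneg hk0 (by linarith) hη hη1 hb hR h
    have hexp : Real.exp (-(t * (F (slantRay k η R) lam).im)) ≤ 1 :=
      Real.exp_le_one_iff.2 (neg_nonpos.2 (by positivity))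
    nlinarith
  · have him := le_im_F_slantRay hk0 hk1 hη hη1 hlam hb h
    have hexp : Real.exp (-(t * (F (slantRay k η R) lam).im)) ≤ Real.exp (-(R - k)) := by
      gcongr
      nlinarith
    have hsq : (1 + R) ^ 2 ≤ 4 * Real.exp (R - k) := by
      have := sq_one_add_le_exp (s := (R - k) / 2) (by linarith)
      rw [mul_div_cancel₀ _ two_ne_zero] at this
      nlinarith
    calc _ ≤ Real.exp (-(R - k)) * (4 * Real.exp (R - k)) := by gcongr
      _ = 4 := by rw [mul_left_comm, ← Real.exp_add, neg_add_cancel, Real.exp_zero, mul_one]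

end SlantRay

section Contour

/-- The integrand in the case `σ = 1/2`. -/
noncomputable def halfIntegrand (t lam : ℝ) (z : ℂ) : ℂ :=
  (1 - z) ^ (-(1 / 2) : ℂ) * Complex.exp (Complex.I * t * F z lam)

theorem integrand_half (t lam : ℝ) : integrand (1 / 2) t lam = halfIntegrand t lam := by
  ext z
  simp [integrand, halfIntegrand]

theorem differentiableAt_halfIntegrand (t lam : ℝ) {z : ℂ} (hz : z ∈ cutPlane) :
    DifferentiableAt ℂ (halfIntegrand t lam) z :=
  ((hasDerivAt_one_sub_cpow hz).mul (hasDerivAt_exp_phase hz t lam)).differentiableAt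

/-- A convex region of the upper half plane on which the integrand is uniformly small. -/
def decayRegion (lam q r : ℝ) : Set ℂ := {z | q ≤ z.im ∧ r ≤ decayRate lam (z - 1)}

theorem convex_decayRegion (lam q r : ℝ) : Convex ℝ (decayRegion lam q r) := by
  have hlin : IsLinearMap ℝ (decayRate lam) :=
    ⟨fun z w => by simp only [decayRate, Complex.add_re, Complex.add_im]; ring, fun c z => by
      simp only [decayRate, Complex.smul_re, Complex.smul_im, smul_eq_mul]; ring⟩
  have hset : decayRegion lam q r = {z | q ≤ z.im} ∩ {z | r + Real.pi ≤ decayRate lam z} := by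
    ext z
    simp only [decayRegion, Set.mem_inter_iff, Set.mem_ofPred_eq, hlin.map_sub]
    simp [decayRate, le_sub_iff_add_le]
  rw [hset]
  exact (convex_halfSpace_im_ge q).inter (convex_halfSpace_ge hlin _)

theorem norm_halfIntegrand_le {t lam q r : ℝ} (ht : 0 ≤ t) (hq : 0 < q) {z : ℂ}
    (hz : z ∈ decayRegion lam q r) :
    ‖halfIntegrand t lam z‖ ≤ q ^ (-(1 / 2) : ℝ) * Real.exp (-(t * r)) := by
  have him : z.im ≤ ‖1 - z‖ := by
    simpa using (neg_le_abs _).trans (Complex.abs_im_le_norm (1 - z))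
  rw [halfIntegrand, norm_mul, norm_one_sub_cpow_neg_half, norm_exp_phase]
  have him_F := hz.2.trans (decayRate_sub_one_le_im_F (hq.trans_le hz.1) lam)
  exact mul_le_mul (Real.rpow_le_rpow_of_nonpos hq (hz.1.trans him) (by norm_num)) (by gcongr)
    (Real.exp_pos _).le (by positivity)

theorem ray_mem_decayRegion {lam x q e R : ℝ} {v : ℂ} (hx : 0 ≤ x) (hq : 0 ≤ q) (hqv : q ≤ v.im)
    (he : e ≤ decayRate lam v) (hR : 1 ≤ R) :
    ray x v R ∈ decayRegion lam q (e * R - Real.pi) := by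
  refine ⟨?_, ?_⟩
  · rw [ray_im]
    nlinarith
  · have hrate : decayRate lam (ray x v R - 1) = decayRate lam v * R - Real.pi + Real.pi * x := by
      simp only [decayRate, Complex.sub_re, ray_re, Complex.one_re, Complex.sub_im, ray_im,
        Complex.one_im, sub_zero]
      ring
    have := mul_le_mul_of_nonneg_right he (zero_le_one.trans hR)
    rw [hrate]
    linarith [mul_nonneg Real.pi_pos.le hx]

/-- A direction pointing into the upper right quadrant in which the integrand decays. -/
structure IsDecayDirection (lam : ℝ) (v : ℂ) : Prop where
  re_pos : 0 < v.re
  im_pos : 0 < v.im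
  rate_pos : 0 < decayRate lam v

theorem continuousOn_halfIntegrand_ray {x : ℝ} {v : ℂ} (hx0 : 0 < x) (hx1 : x < 1) (hv : 0 < v.im)
    (t lam : ℝ) : ContinuousOn (fun R => halfIntegrand t lam (ray x v R)) (Set.Ici 0) :=
  fun R hR => ((differentiableAt_halfIntegrand t lam
    (ray_mem_cutPlane hx0 hx1 hv hR)).continuousAt.comp
      (hasDerivAt_ray x v R).continuousAt).continuousWithinAt

theorem integrableOn_halfIntegrand_ray {t lam x : ℝ} {v : ℂ} (ht : 0 < t) (hx0 : 0 < x)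
    (hx1 : x < 1) (hv : IsDecayDirection lam v) :
    IntegrableOn (fun R => halfIntegrand t lam (ray x v R)) (Set.Ioi 0) := by
  have hcont := continuousOn_halfIntegrand_ray hx0 hx1 hv.im_pos t lam
  rw [IntegrableOn, ← integrable_norm_iff
    ((hcont.mono Set.Ioi_subset_Ici_self).aestronglyMeasurable measurableSet_Ioi)]
  refine integrable_of_isBigO_exp_neg (mul_pos ht hv.rate_pos) hcont.norm
    (IsBigO.of_bound (v.im ^ (-(1 / 2) : ℝ) * Real.exp (t * Real.pi)) ?_)
  filter_upwards [eventually_ge_atTop 1] with R hR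
  rw [norm_norm, Real.norm_of_nonneg (Real.exp_pos _).le, mul_assoc, ← Real.exp_add]
  exact (norm_halfIntegrand_le ht.le hv.im_pos
    (ray_mem_decayRegion hx0.le hv.im_pos.le le_rfl le_rfl hR)).trans_eq (by ring_nf)

theorem tendsto_primitive_ray {t lam x : ℝ} {v : ℂ} (ht : 0 < t) (hx0 : 0 < x) (hx1 : x < 1)
    (hv : IsDecayDirection lam v) {g : ℂ → ℂ}
    (hg : ∀ R, 0 ≤ R → HasDerivAt g (halfIntegrand t lam (ray x v R)) (ray x v R)) :
    Tendsto (fun R => g (ray x v R)) atTop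
      (nhds (g x + ∫ R in Set.Ioi (0 : ℝ), halfIntegrand t lam (ray x v R) * v)) := by
  have hint : IntegrableOn (fun R => halfIntegrand t lam (ray x v R) * v) (Set.Ioi 0) :=
    (integrableOn_halfIntegrand_ray ht hx0 hx1 hv).mul_const _
  refine ((intervalIntegral_tendsto_integral_Ioi 0 hint tendsto_id).const_add (g x)).congr' ?_
  filter_upwards [eventually_ge_atTop 0] with R hR
  rw [id, intervalIntegral.integral_eq_sub_of_hasDerivAt (f := fun R => g (ray x v R)),
    ray_zero, add_sub_cancel]
  · intro y hy
    rw [Set.uIcc_of_le hR] at hy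
    exact (hg y hy.1).comp y (hasDerivAt_ray x v y)
  · rw [intervalIntegrable_iff_integrableOn_Ioc_of_le hR]
    exact hint.mono_set Set.Ioc_subset_Ioi_self

theorem norm_ray_sub_ray_le (x y : ℝ) (v w : ℂ) {R : ℝ} (hR : 1 ≤ R) :
    ‖ray y w R - ray x v R‖ ≤ (|y - x| + ‖w - v‖) * R := by
  have hsub : ray y w R - ray x v R = ((y - x : ℝ) : ℂ) + R * (w - v) := by
    simp only [ray]
    push_cast
    ring
  calc _ ≤ |y - x| + R * ‖w - v‖ := by
        rw [hsub]
        refine (norm_add_le _ _).trans_eq ?_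
        rw [norm_mul, Complex.norm_real, Complex.norm_real, Real.norm_eq_abs, Real.norm_eq_abs,
          abs_of_nonneg (zero_le_one.trans hR)]
    _ ≤ _ := by nlinarith [abs_nonneg (y - x)]

theorem tendsto_primitive_ray_sub {t lam x y : ℝ} {v w : ℂ} (ht : 0 < t) (hx : 0 ≤ x) (hy : 0 ≤ y)
    (hv : IsDecayDirection lam v) (hw : IsDecayDirection lam w) {s : Set ℂ} (hs : Convex ℝ s)
    (hvs : ∀ R, 0 ≤ R → ray x v R ∈ s) (hws : ∀ R, 0 ≤ R → ray y w R ∈ s) {g : ℂ → ℂ}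
    (hg : ∀ z ∈ s, HasDerivAt g (halfIntegrand t lam z) z) :
    Tendsto (fun R => g (ray y w R) - g (ray x v R)) atTop (nhds 0) := by
  set e := min (decayRate lam v) (decayRate lam w)
  set q := min v.im w.im
  set C := q ^ (-(1 / 2) : ℝ) * Real.exp (t * Real.pi) * (|y - x| + ‖w - v‖)
  have he : 0 < e := lt_min hv.rate_pos hw.rate_pos
  have hq : 0 < q := lt_min hv.im_pos hw.im_pos
  have hbound : ∀ᶠ R : ℝ in atTop, ‖g (ray y w R) - g (ray x v R)‖
      ≤ C * (R ^ (1 : ℝ) * Real.exp (-(t * e) * R)) := by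
    filter_upwards [eventually_ge_atTop 1] with R hR
    have hR0 : 0 ≤ R := by linarith
    have hconv := hs.inter (convex_decayRegion lam q (e * R - Real.pi))
    refine (hconv.norm_image_sub_le_of_norm_hasDerivWithin_le
      (fun z hz => (hg z hz.1).hasDerivWithinAt) (fun z hz => norm_halfIntegrand_le ht.le hq hz.2)
      ⟨hvs R hR0, ray_mem_decayRegion hx hq.le (min_le_left _ _) (min_le_left _ _) hR⟩
      ⟨hws R hR0, ray_mem_decayRegion hy hq.le (min_le_right _ _) (min_le_right _ _) hR⟩).trans ?_
    calc _ ≤ q ^ (-(1 / 2) : ℝ) * Real.exp (-(t * (e * R - Real.pi)))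
          * ((|y - x| + ‖w - v‖) * R) := by
          gcongr
          exact norm_ray_sub_ray_le x y v w hR
      _ = C * (R ^ (1 : ℝ) * Real.exp (-(t * e) * R)) := by
          rw [show -(t * (e * R - Real.pi)) = t * Real.pi + -(t * e) * R by ring, Real.exp_add,
            Real.rpow_one]
          ring
  refine squeeze_zero_norm' hbound ?_
  simpa using (tendsto_rpow_mul_exp_neg_mul_atTop_nhds_zero 1 (t * e) (by positivity)).const_mul C

/-- A convex part of the cut plane, bounded by a line of slope `s` through `1`. -/
def wedge (s : ℝ) : Set ℂ := {z | 0 < z.re ∧ s * (z.re - 1) < z.im}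

theorem isOpen_wedge (s : ℝ) : IsOpen (wedge s) :=
  (isOpen_lt continuous_const Complex.continuous_re).inter
    (isOpen_lt (by fun_prop) Complex.continuous_im)

theorem convex_wedge (s : ℝ) : Convex ℝ (wedge s) := by
  have hlin : IsLinearMap ℝ fun z : ℂ => s * z.re - z.im :=
    ⟨fun z w => by simp only [Complex.add_re, Complex.add_im]; ring, fun c z => by
      simp only [Complex.smul_re, Complex.smul_im, smul_eq_mul]; ring⟩
  have hset : wedge s = {z | 0 < z.re} ∩ {z | s * z.re - z.im < s} := by
    ext z
    simp only [wedge, Set.mem_inter_iff, Set.mem_ofPred_eq]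
    exact and_congr_right fun _ => ⟨fun h => by linarith, fun h => by linarith⟩
  rw [hset]
  exact (convex_halfSpace_re_gt 0).inter (convex_halfSpace_lt hlin s)

theorem wedge_subset_cutPlane {s : ℝ} (hs : 0 < s) : wedge s ⊆ cutPlane := by
  rintro z ⟨hre, him⟩
  refine ⟨Or.inl hre, ?_⟩
  rcases eq_or_ne z.im 0 with h | h
  · exact Or.inl (by simpa [h, mul_neg_iff, hs, hs.not_gt] using him)
  · exact Or.inr (by simpa using h)

theorem ray_mem_wedge {s x R : ℝ} {v : ℂ} (hs : 0 < s) (hx0 : 0 < x) (hx1 : x < 1)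
    (hv : 0 ≤ v.re) (hsv : s * v.re ≤ v.im) (hR : 0 ≤ R) : ray x v R ∈ wedge s := by
  refine ⟨?_, ?_⟩
  · rw [ray_re]; positivity
  · rw [ray_re, ray_im]
    nlinarith [mul_nonneg hR (sub_nonneg.2 hsv)]

theorem AdmissibleAngle.isDecayDirection {lam φ : ℝ} (h : AdmissibleAngle lam φ) :
    IsDecayDirection lam (Complex.exp (Complex.I * φ)) := by
  obtain ⟨h0, hnonneg, hneg⟩ := h
  have hlt : φ < Real.pi / 2 := (le_or_gt 0 (Real.log lam)).elim hnonneg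
    fun h => (hneg h).trans (Real.arctan_lt_pi_div_two _)
  have hcos : 0 < Real.cos φ := Real.cos_pos_of_mem_Ioo ⟨by linarith, hlt⟩
  have hsin : 0 < Real.sin φ := Real.sin_pos_of_pos_of_lt_pi h0 (by linarith [Real.pi_pos])
  have hrate : 0 < Real.pi * Real.cos φ + Real.sin φ * Real.log lam := by
    rcases le_or_gt 0 (Real.log lam) with h | h
    · have := Real.pi_pos
      positivity
    · have htan := Real.tan_lt_tan_of_lt_of_lt_pi_div_two (by linarith)
        (Real.arctan_lt_pi_div_two _) (hneg h)
      rw [Real.tan_arctan, abs_of_neg h, Real.tan_eq_sin_div_cos,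
        div_lt_div_iff₀ hcos (by linarith)] at htan
      linarith
  rw [mul_comm, Complex.exp_mul_I]
  constructor <;> simp [decayRate, Complex.cos_ofReal_re, Complex.sin_ofReal_re, *]

theorem rayIntegrand_eq (δ t lam φ R : ℝ) :
    rayIntegrand δ (1 / 2) t lam φ R
      = halfIntegrand t lam (ray (z₀ δ t) (Complex.exp (Complex.I * φ)) R)
        * Complex.exp (Complex.I * φ) := by
  rw [rayIntegrand, integrand_half, ray]

theorem integrableOn_rayIntegrand {δ t lam φ : ℝ} (ht : 0 < t) (h0 : 0 < z₀ δ t) (h1 : z₀ δ t < 1)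
    (hφ : AdmissibleAngle lam φ) :
    IntegrableOn (rayIntegrand δ (1 / 2) t lam φ) (Set.Ioi 0) := by
  rw [funext (rayIntegrand_eq δ t lam φ)]
  exact (integrableOn_halfIntegrand_ray ht h0 h1 hφ.isDecayDirection).mul_const _

theorem exists_primitive_tendsto_JB {δ t lam φ x : ℝ} {v : ℂ} (ht : 0 < t) (h0 : 0 < z₀ δ t)
    (h1 : z₀ δ t < 1) (hφ : AdmissibleAngle lam φ) (hx0 : 0 < x) (hx1 : x < 1)
    (hv : IsDecayDirection lam v) :
    ∃ g : ℂ → ℂ, (∀ y : ℝ, 0 < y → y < 1 → HasDerivAt g (halfIntegrand t lam y) y) ∧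
      (∀ R, 0 ≤ R → HasDerivAt g (halfIntegrand t lam (ray x v R)) (ray x v R)) ∧
      Tendsto (fun R => g (ray x v R)) atTop (nhds (g (z₀ δ t) + JB δ (1 / 2) t lam φ)) := by
  have hu := hφ.isDecayDirection
  set u := Complex.exp (Complex.I * φ)
  set s := min (u.im / u.re) (v.im / v.re)
  have hs : 0 < s := lt_min (div_pos hu.im_pos hu.re_pos) (div_pos hv.im_pos hv.re_pos)
  have hray_u (R : ℝ) (hR : 0 ≤ R) : ray (z₀ δ t) u R ∈ wedge s :=
    ray_mem_wedge hs h0 h1 hu.re_pos.le ((le_div_iff₀ hu.re_pos).1 (min_le_left _ _)) hR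
  have hray_v {y : ℝ} (hy0 : 0 < y) (hy1 : y < 1) (R : ℝ) (hR : 0 ≤ R) : ray y v R ∈ wedge s :=
    ray_mem_wedge hs hy0 hy1 hv.re_pos.le ((le_div_iff₀ hv.re_pos).1 (min_le_right _ _)) hR
  obtain ⟨g, hg'⟩ := (convex_wedge s).exists_forall_hasDerivWithinAt fun z hz =>
    (differentiableAt_halfIntegrand t lam (wedge_subset_cutPlane hs hz)).differentiableWithinAt
  have hg (z : ℂ) (hz : z ∈ wedge s) : HasDerivAt g (halfIntegrand t lam z) z :=
    (hg' z hz).hasDerivAt ((isOpen_wedge s).mem_nhds hz)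
  refine ⟨g, fun y hy0 hy1 => ?_, fun R hR => hg _ (hray_v hx0 hx1 R hR), ?_⟩
  · simpa only [ray_zero] using hg _ (hray_v hy0 hy1 0 le_rfl)
  · have hlim := (tendsto_primitive_ray_sub ht h0.le hx0.le hu hv (convex_wedge s) hray_u
      (hray_v hx0 hx1) hg).add (tendsto_primitive_ray ht h0 h1 hu fun R hR => hg _ (hray_u R hR))
    simp only [sub_add_cancel, zero_add] at hlim
    rwa [JB, funext (rayIntegrand_eq δ t lam φ)]

end Contour

section Endpoint

theorem abs_one_add_mul_log_sub_le {x : ℝ} (hx : |x| ≤ 1 / 2) :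
    |(1 + x) * Real.log (1 + x) - x - x ^ 2 / 2| ≤ 4 * |x| ^ 3 := by
  have hlog : |-x + x ^ 2 / 2 + Real.log (1 + x)| ≤ |x| ^ 3 / (1 - |x|) := by
    simpa [Finset.sum_range_succ, one_add_one_eq_two] using
      Real.abs_log_sub_add_sum_range_le (x := -x) (by rw [abs_neg]; linarith) 2
  have hcube : |x| ^ 3 / (1 - |x|) ≤ 2 * |x| ^ 3 := by
    rw [div_le_iff₀ (by linarith)]
    nlinarith [pow_nonneg (abs_nonneg x) 3]
  have habs : |1 + x| ≤ 3 / 2 := by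
    have := abs_le.1 hx
    exact abs_le.2 ⟨by linarith, by linarith⟩
  calc |(1 + x) * Real.log (1 + x) - x - x ^ 2 / 2|
      = |(1 + x) * (-x + x ^ 2 / 2 + Real.log (1 + x)) - x ^ 3 / 2| := by ring_nf
    _ ≤ |1 + x| * |-x + x ^ 2 / 2 + Real.log (1 + x)| + |x| ^ 3 / 2 := by
      refine (abs_sub _ _).trans_eq ?_
      rw [abs_mul, abs_div, abs_pow, abs_of_pos (two_pos : (0 : ℝ) < 2)]
    _ ≤ 3 / 2 * (2 * |x| ^ 3) + |x| ^ 3 / 2 := by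
      gcongr
      exact hlog.trans hcube
    _ ≤ 4 * |x| ^ 3 := by linarith [pow_nonneg (abs_nonneg x) 3]

/-- The phase `F(x;λ)` at a real point `x` of `[0,1]`, as a real number. -/
noncomputable def realPhase (lam x : ℝ) : ℝ :=
  (1 - x) * Real.log (1 - x) + x * Real.log x + x * Real.log lam

theorem F_ofReal {x : ℝ} (h0 : 0 ≤ x) (h1 : x ≤ 1) (lam : ℝ) :
    F x lam = (realPhase lam x : ℂ) := by
  rw [F, realPhase, ← Complex.ofReal_log h0, ← Complex.ofReal_one, ← Complex.ofReal_sub,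
    ← Complex.ofReal_log (sub_nonneg.2 h1)]
  push_cast
  ring

/-- The second-order Taylor polynomial at `s = 0` of `s ↦ realPhase lam (1 - p + p s)`; for
`p = t^(δ-1)` the quotient `p / (1 - p)` is `λ_c`. -/
noncomputable def quadPhase (lam p s : ℝ) : ℝ :=
  realPhase lam (1 - p) + p * s * Real.log (lam / (p / (1 - p))) + p / (1 - p) * s ^ 2 / 2

theorem realPhase_sub_quadPhase {p s lam : ℝ} (hp0 : 0 < p) (hp1 : p < 1) (hs0 : 0 ≤ s)
    (hs1 : s < 1) (hlam : 0 < lam) :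
    realPhase lam (1 - p + p * s) - quadPhase lam p s
      = p * ((1 + -s) * Real.log (1 + -s) - -s - (-s) ^ 2 / 2)
        + (1 - p) * ((1 + p / (1 - p) * s) * Real.log (1 + p / (1 - p) * s)
          - p / (1 - p) * s - (p / (1 - p) * s) ^ 2 / 2) := by
  have hq : 0 < 1 - p := by linarith
  rw [quadPhase]
  set ρ := p / (1 - p) with hρ
  have hρ0 : 0 < ρ := by positivity
  have hqρ : (1 - p) * ρ = p := mul_div_cancel₀ p hq.ne'
  have hlog_left : Real.log (1 - (1 - p + p * s)) = Real.log p + Real.log (1 + -s) := by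
    rw [← Real.log_mul hp0.ne' (by linarith)]
    congr 1
    ring
  have hlog_right : Real.log (1 - p + p * s) = Real.log (1 - p) + Real.log (1 + ρ * s) := by
    rw [← Real.log_mul hq.ne' (by positivity)]
    congr 1
    linear_combination (-s) * hqρ
  have hlog_ratio : Real.log (lam / ρ) = Real.log lam - (Real.log p - Real.log (1 - p)) := by
    rw [Real.log_div hlam.ne' hρ0.ne', hρ, Real.log_div hp0.ne' hq.ne']
  rw [realPhase, realPhase, hlog_left, hlog_right, hlog_ratio, sub_sub_cancel]
  linear_combination (s - s * Real.log (1 + ρ * s) + (ρ - 1) * s ^ 2 / 2) * hqρ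

theorem abs_realPhase_sub_quadPhase_le {p s lam : ℝ} (hp0 : 0 < p) (hp1 : p ≤ 1 / 2) (hs0 : 0 ≤ s)
    (hs1 : s ≤ 1 / 2) (hlam : 0 < lam) :
    |realPhase lam (1 - p + p * s) - quadPhase lam p s| ≤ 8 * p * s ^ 3 := by
  have hq : 0 < 1 - p := by linarith
  rw [realPhase_sub_quadPhase hp0 (by linarith) hs0 (by linarith) hlam]
  set ρ := p / (1 - p) with hρ
  have hρ0 : 0 < ρ := by positivity
  have hρ1 : ρ ≤ 1 := by rw [hρ, div_le_one hq]; linarith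
  have hqρ : (1 - p) * ρ = p := mul_div_cancel₀ p hq.ne'
  have hleft := abs_one_add_mul_log_sub_le (x := -s) (by rwa [abs_neg, abs_of_nonneg hs0])
  have hright := abs_one_add_mul_log_sub_le (x := ρ * s) (by
    rw [abs_of_nonneg (by positivity)]
    nlinarith)
  rw [abs_neg, abs_of_nonneg hs0] at hleft
  rw [abs_of_nonneg (show 0 ≤ ρ * s by positivity)] at hright
  calc |p * ((1 + -s) * Real.log (1 + -s) - -s - (-s) ^ 2 / 2)
        + (1 - p) * ((1 + ρ * s) * Real.log (1 + ρ * s) - ρ * s - (ρ * s) ^ 2 / 2)|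
      ≤ p * (4 * s ^ 3) + (1 - p) * (4 * (ρ * s) ^ 3) := by
        refine (abs_add_le _ _).trans ?_
        rw [abs_mul, abs_mul, abs_of_pos hp0, abs_of_pos hq]
        gcongr
    _ = 4 * p * s ^ 3 + 4 * p * s ^ 3 * ρ ^ 2 := by
        linear_combination (4 * ρ ^ 2 * s ^ 3) * hqρ
    _ ≤ 4 * p * s ^ 3 + 4 * p * s ^ 3 := by
        exact add_le_add le_rfl
          (mul_le_of_le_one_right (by positivity) (pow_le_one₀ hρ0.le hρ1))
    _ = 8 * p * s ^ 3 := by ring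

theorem norm_exp_I_mul_ofReal_sub_le (x y : ℝ) :
    ‖Complex.exp (Complex.I * x) - Complex.exp (Complex.I * y)‖ ≤ |x - y| := by
  have hfactor : Complex.exp (Complex.I * x) - Complex.exp (Complex.I * y)
      = Complex.exp (Complex.I * y) * (Complex.exp (Complex.I * (x - y : ℝ)) - 1) := by
    rw [mul_sub, ← Complex.exp_add, mul_one]
    congr 2
    push_cast
    ring
  rw [hfactor, norm_mul, Complex.norm_exp_I_mul_ofReal, one_mul]
  exact Real.norm_exp_I_mul_ofReal_sub_one_le

theorem abs_rpow_neg_half_sub_one_le {s : ℝ} (hs0 : 0 ≤ s) (hs1 : s ≤ 1 / 2) :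
    |(1 - s) ^ (-(1 / 2) : ℝ) - 1| ≤ s := by
  have h0 : 0 < 1 - s := by linarith
  have h1 : 1 ≤ (1 - s) ^ (-(1 / 2) : ℝ) :=
    Real.one_le_rpow_of_pos_of_le_one_of_nonpos h0 (by linarith) (by norm_num)
  rw [abs_of_nonneg (by linarith), sub_le_iff_le_add, Real.rpow_neg h0.le, ← Real.sqrt_eq_rpow]
  refine inv_le_of_inv_le₀ (by positivity) (Real.le_sqrt_of_sq_le ?_)
  rw [inv_pow, inv_le_comm₀ (by positivity) h0, inv_le_iff_one_le_mul₀ h0]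
  nlinarith [mul_nonneg hs0 (show 0 ≤ 1 - s - s ^ 2 by nlinarith)]

theorem halfIntegrand_one_sub_add_mul {t lam p s : ℝ} (hp0 : 0 < p) (hp1 : p ≤ 1) (hs0 : 0 ≤ s)
    (hs1 : s < 1) :
    halfIntegrand t lam ((1 - p + p * s : ℝ) : ℂ) * p
      = Real.sqrt p * (((1 - s) ^ (-(1 / 2) : ℝ) : ℝ) : ℂ)
        * Complex.exp (Complex.I * (t * realPhase lam (1 - p + p * s) : ℝ)) := by
  have h1s : 0 < 1 - s := by linarith
  have hbase : (1 - ((1 - p + p * s : ℝ) : ℂ)) ^ (-(1 / 2) : ℂ)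
      = (((p * (1 - s)) ^ (-(1 / 2) : ℝ) : ℝ) : ℂ) := by
    rw [Complex.ofReal_cpow (by positivity)]
    push_cast
    congr 1
    ring
  have hamp : (p * (1 - s)) ^ (-(1 / 2) : ℝ) * p = Real.sqrt p * (1 - s) ^ (-(1 / 2) : ℝ) := by
    rw [Real.mul_rpow hp0.le h1s.le, mul_right_comm, ← Real.rpow_add_one hp0.ne',
      Real.sqrt_eq_rpow]
    norm_num
  rw [halfIntegrand, hbase, F_ofReal (by nlinarith) (by nlinarith), mul_right_comm,
    ← Complex.ofReal_mul, hamp]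
  push_cast
  simp only [mul_assoc]

theorem norm_halfIntegrand_sub_quadPhase_le {t lam p s : ℝ} (ht : 0 < t) (hp0 : 0 < p)
    (hp1 : p ≤ 1 / 2) (hlam : 0 < lam) (hs0 : 0 ≤ s) (hs1 : s ≤ 1 / 2) :
    ‖halfIntegrand t lam ((1 - p + p * s : ℝ) : ℂ) * p
        - Real.sqrt p * Complex.exp (Complex.I * (t * quadPhase lam p s : ℝ))‖
      ≤ Real.sqrt p * (s + 8 * (t * p) * s ^ 3) := by
  rw [halfIntegrand_one_sub_add_mul hp0 (by linarith) hs0 (by linarith)]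
  set X := t * realPhase lam (1 - p + p * s) with hX
  set Y := t * quadPhase lam p s with hY
  set r := (1 - s) ^ (-(1 / 2) : ℝ)
  have hsplit : (Real.sqrt p : ℂ) * (r : ℂ) * Complex.exp (Complex.I * X)
      - Real.sqrt p * Complex.exp (Complex.I * Y)
      = Real.sqrt p * ((r - 1 : ℝ) * Complex.exp (Complex.I * X)
        + (Complex.exp (Complex.I * X) - Complex.exp (Complex.I * Y))) := by
    push_cast
    ring
  have hamp : ‖((r - 1 : ℝ) : ℂ) * Complex.exp (Complex.I * X)‖ ≤ s := by
    rw [norm_mul, Complex.norm_exp_I_mul_ofReal, mul_one, Complex.norm_real]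
    exact abs_rpow_neg_half_sub_one_le hs0 hs1
  have hphase : |X - Y| ≤ 8 * (t * p) * s ^ 3 := by
    rw [hX, hY, ← mul_sub, abs_mul, abs_of_pos ht]
    linarith [mul_le_mul_of_nonneg_left
      (abs_realPhase_sub_quadPhase_le hp0 hp1 hs0 hs1 hlam) ht.le]
  rw [hsplit, norm_mul, Complex.norm_real, Real.norm_of_nonneg (Real.sqrt_nonneg p)]
  gcongr
  exact (norm_add_le _ _).trans
    (add_le_add hamp ((norm_exp_I_mul_ofReal_sub_le X Y).trans hphase))

theorem sub_eq_integral_halfIntegrand {t lam p a : ℝ} (hp0 : 0 < p) (hp1 : p < 1) (ha0 : 0 ≤ a)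
    (ha1 : a < 1) {g : ℂ → ℂ}
    (hg : ∀ x : ℝ, 0 < x → x < 1 → HasDerivAt g (halfIntegrand t lam x) x) :
    IntervalIntegrable (fun s : ℝ => halfIntegrand t lam ((1 - p + p * s : ℝ) : ℂ) * p) volume 0 a ∧
      g ((1 - p + p * a : ℝ) : ℂ) - g ((1 - p : ℝ) : ℂ)
        = ∫ s in (0 : ℝ)..a, halfIntegrand t lam ((1 - p + p * s : ℝ) : ℂ) * p := by
  have hmem : ∀ s ∈ Set.uIcc 0 a, 0 < 1 - p + p * s ∧ 1 - p + p * s < 1 := fun s hs => by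
    rw [Set.uIcc_of_le ha0] at hs
    constructor <;> nlinarith [hs.1, hs.2]
  have hseg : ∀ s : ℝ, HasDerivAt (fun s : ℝ => ((1 - p + p * s : ℝ) : ℂ)) (p : ℂ) s := fun s => by
    simpa using (((hasDerivAt_id s).const_mul p).const_add (1 - p)).ofReal_comp
  have hderiv : ∀ s ∈ Set.uIcc 0 a, HasDerivAt (fun s : ℝ => g ((1 - p + p * s : ℝ) : ℂ))
      (halfIntegrand t lam ((1 - p + p * s : ℝ) : ℂ) * p) s := fun s hs =>
    (hg _ (hmem s hs).1 (hmem s hs).2).comp s (hseg s)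
  have hcont : ContinuousOn (fun s : ℝ => halfIntegrand t lam ((1 - p + p * s : ℝ) : ℂ) * p)
      (Set.uIcc 0 a) := fun s hs =>
    ((ContinuousAt.comp (f := fun s : ℝ => ((1 - p + p * s : ℝ) : ℂ))
      (differentiableAt_halfIntegrand t lam
        (ofReal_mem_cutPlane (hmem s hs).1 (hmem s hs).2)).continuousAt
      (hseg s).continuousAt).mul_const _).continuousWithinAt
  refine ⟨hcont.intervalIntegrable, ?_⟩
  simpa only [mul_zero, add_zero] using
    (intervalIntegral.integral_eq_sub_of_hasDerivAt hderiv hcont.intervalIntegrable).symm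

theorem omega_eq {δ t : ℝ} (lam : ℝ) (hp : t ^ (δ - 1) < 1) :
    omega δ t lam
      = Real.sqrt (lamC δ t * t / 2) * (Real.log (lam / lamC δ t) * (1 - t ^ (δ - 1))) := by
  have hq : 1 - t ^ (δ - 1) ≠ 0 := by linarith
  have hone : 1 + lamC δ t = (1 - t ^ (δ - 1))⁻¹ := by
    rw [lamC]
    field_simp
    ring
  rw [omega, bigLam, add_sub_cancel, hone, div_inv_eq_mul]

theorem mul_quadPhase_eq {δ t lam : ℝ} (ht : 0 < t) (hp : t ^ (δ - 1) < 1) (s : ℝ) :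
    t * quadPhase lam (t ^ (δ - 1)) s = t * realPhase lam (1 - t ^ (δ - 1)) - omega δ t lam ^ 2
      + (Real.sqrt (lamC δ t * t / 2) * s + omega δ t lam) ^ 2 := by
  have hq : 0 < 1 - t ^ (δ - 1) := by linarith
  have hρ : 0 < lamC δ t := div_pos (Real.rpow_pos_of_pos ht _) hq
  have hqρ : (1 - t ^ (δ - 1)) * lamC δ t = t ^ (δ - 1) := mul_div_cancel₀ _ hq.ne'
  have hβ : Real.sqrt (lamC δ t * t / 2) ^ 2 = lamC δ t * t / 2 := Real.sq_sqrt (by positivity)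
  rw [quadPhase, ← lamC, omega_eq lam hp]
  set ℓ := Real.log (lam / lamC δ t)
  linear_combination (-(s ^ 2) - 2 * s * ℓ * (1 - t ^ (δ - 1))) * hβ - t * s * ℓ * hqρ

theorem fresnelTerm_coeff {δ t : ℝ} (ht : 0 < t) (hp : t ^ (δ - 1) < 1) :
    t ^ (-(1 / 2) : ℝ) * Real.sqrt (2 / (1 + lamC δ t)) * Real.sqrt (lamC δ t * t / 2)
      = Real.sqrt (t ^ (δ - 1)) := by
  have hq : 0 < 1 - t ^ (δ - 1) := by linarith
  have hρ : 0 < lamC δ t := div_pos (Real.rpow_pos_of_pos ht _) hq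
  have hqρ : (1 - t ^ (δ - 1)) * lamC δ t = t ^ (δ - 1) := mul_div_cancel₀ _ hq.ne'
  rw [Real.rpow_neg ht.le, ← Real.sqrt_eq_rpow, ← Real.sqrt_inv,
    ← Real.sqrt_mul (by positivity), ← Real.sqrt_mul (by positivity)]
  congr 1
  field_simp
  linear_combination hqρ

theorem fresnelTerm_eq_integral_quadPhase {δ t : ℝ} (lam a : ℝ) (ht : 0 < t)
    (hp : t ^ (δ - 1) < 1) :
    fresnelTerm δ t lam a = ∫ s in (0 : ℝ)..a, Real.sqrt (t ^ (δ - 1))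
      * Complex.exp (Complex.I * ((t * quadPhase lam (t ^ (δ - 1)) s : ℝ) : ℂ)) := by
  have hq : 0 < 1 - t ^ (δ - 1) := by linarith
  have hρ : 0 < lamC δ t := div_pos (Real.rpow_pos_of_pos ht _) hq
  rw [fresnelTerm, z₀, F_ofReal hq.le (sub_le_self _ (Real.rpow_pos_of_pos ht _).le),
    ← fresnelTerm_coeff ht hp]
  simp only [mul_quadPhase_eq ht hp]
  set ω := omega δ t lam
  set β := Real.sqrt (lamC δ t * t / 2)
  have hβ : β ≠ 0 := (Real.sqrt_pos.2 (by positivity)).ne'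
  have hsubst : ∫ ξ in ω..(ω + a * β), Complex.exp (Complex.I * (ξ : ℂ) ^ 2)
      = β * ∫ s in (0 : ℝ)..a, Complex.exp (Complex.I * ((β * s + ω : ℝ) : ℂ) ^ 2) := by
    rw [intervalIntegral.integral_comp_mul_add (fun x : ℝ => Complex.exp (Complex.I * (x : ℂ) ^ 2))
      hβ, Complex.real_smul, mul_zero, zero_add, ← mul_assoc, ← Complex.ofReal_mul,
      mul_inv_cancel₀ hβ, Complex.ofReal_one, one_mul, add_comm, mul_comm a]
  rw [hsubst, ← mul_assoc, ← intervalIntegral.integral_const_mul]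
  refine intervalIntegral.integral_congr fun s _ => ?_
  simp only [Complex.ofReal_add, Complex.ofReal_sub, Complex.ofReal_mul, Complex.ofReal_pow,
    mul_add, mul_sub, Complex.exp_add, Complex.exp_sub, mul_assoc]
  ring

theorem norm_sub_fresnelTerm_le {δ t lam a : ℝ} (ht : 0 < t) (hp : t ^ (δ - 1) ≤ 1 / 2)
    (hlam : 0 < lam) (ha0 : 0 < a) (ha1 : a ≤ 1 / 2) {g : ℂ → ℂ}
    (hg : ∀ x : ℝ, 0 < x → x < 1 → HasDerivAt g (halfIntegrand t lam x) x) :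
    ‖g ((1 - splitK δ t a : ℝ) : ℂ) - g (z₀ δ t : ℂ) - fresnelTerm δ t lam a‖
      ≤ Real.sqrt (t ^ (δ - 1)) * (a ^ 2 + 8 * (t * t ^ (δ - 1)) * a ^ 4) := by
  have hp0 : 0 < t ^ (δ - 1) := Real.rpow_pos_of_pos ht _
  rw [show 1 - splitK δ t a = 1 - t ^ (δ - 1) + t ^ (δ - 1) * a by rw [splitK]; ring, z₀]
  obtain ⟨hint, hftc⟩ :=
    sub_eq_integral_halfIntegrand hp0 (by linarith) ha0.le (by linarith) hg
  rw [hftc, fresnelTerm_eq_integral_quadPhase lam a ht (by linarith),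
    ← intervalIntegral.integral_sub hint
      (Continuous.intervalIntegrable (by unfold quadPhase; fun_prop) _ _)]
  have hbound : ∀ s ∈ Set.uIoc 0 a,
      ‖halfIntegrand t lam ((1 - t ^ (δ - 1) + t ^ (δ - 1) * s : ℝ) : ℂ) * (t ^ (δ - 1) : ℝ)
        - Real.sqrt (t ^ (δ - 1))
          * Complex.exp (Complex.I * (t * quadPhase lam (t ^ (δ - 1)) s : ℝ))‖
      ≤ Real.sqrt (t ^ (δ - 1)) * (a + 8 * (t * t ^ (δ - 1)) * a ^ 3) := fun s hs => by
    rw [Set.uIoc_of_le ha0.le] at hs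
    have hs0 : 0 ≤ s := hs.1.le
    refine (norm_halfIntegrand_sub_quadPhase_le ht hp0 hp hlam hs0 (hs.2.trans ha1)).trans ?_
    gcongr <;> exact hs.2
  refine (intervalIntegral.norm_integral_le_of_norm_le_const hbound).trans_eq ?_
  rw [sub_zero, abs_of_pos ha0]
  ring

end Endpoint

section Tail

theorem slantRay_mem_regularSet {k η lam b R : ℝ} (hk0 : 0 < k) (hk1 : k < 1) (hη : 0 < η)
    (hη1 : η ≤ 1) (hb0 : 0 < b) (hb1 : b ≤ 1)
    (hb : b ≤ Real.log (1 - k) - Real.log k + Real.log lam) (hR : 0 ≤ R) :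
    slantRay k η R ∈ regularSet lam :=
  ⟨slantRay_mem_cutPlane hk0 hk1 hη hR,
    norm_pos_iff.1 (hb0.trans_le (le_norm_dF_slantRay hk0 hk1 hη hη1 hb1 hb hR))⟩

theorem exists_norm_iterate_slantRay_le (j : ℕ) : ∃ K : ℝ, 0 ≤ K ∧ ∀ t lam k η b : ℝ, 0 < t →
    0 < k → k ≤ 1 / 2 → 0 < η → η ≤ 1 → 0 < b → b ≤ 1 →
    b ≤ Real.log (1 - k) - Real.log k + Real.log lam → ∀ R, 0 ≤ R →
    ‖(ibpOp t lam)^[j] (ibpStart t lam) (slantRay k η R)‖ * (1 + ‖dF lam (slantRay k η R)‖)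
      ≤ K * t⁻¹ ^ (j + 1) * ibpScale (η * k / 2) b j := by
  obtain ⟨K, hK0, hK⟩ := exists_norm_ibpClosed_le j
  refine ⟨K, hK0, fun t lam k η b ht hk0 hk1 hη hη1 hb0 hb1 hb R hR => ?_⟩
  have hk1' : k < 1 := by linarith
  rw [norm_iterate_ibpOp ht j (slantRay_mem_regularSet hk0 hk1' hη hη1 hb0 hb1 hb hR), mul_assoc]
  calc t⁻¹ ^ (j + 1) * (‖ibpClosed lam j (slantRay k η R)‖ * (1 + ‖dF lam (slantRay k η R)‖))
      ≤ t⁻¹ ^ (j + 1) * (K * ibpScale (η * k / 2) b j) := by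
        refine mul_le_mul_of_nonneg_left ((hK lam b _ (half_le_norm_slantRay hk1 hR) hb0 hb1
          (le_norm_dF_slantRay hk0 hk1' hη hη1 hb1 hb hR)).trans ?_) (by positivity)
        gcongr
        exact ibpScale_anti (by positivity) (le_norm_one_sub_slantRay hk0 hη hη1 R) hb0.le j
    _ = K * t⁻¹ ^ (j + 1) * ibpScale (η * k / 2) b j := by ring

theorem tendsto_sum_ibp_slantRay {t lam k η b : ℝ} (ht : 2 ≤ t) (hk0 : 0 < k) (hk1 : k ≤ 1 / 2)
    (hη : 0 < η) (hη1 : η ≤ 1) (hlam : -1 ≤ η * Real.log lam) (hb0 : 0 < b) (hb1 : b ≤ 1)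
    (hb : b ≤ Real.log (1 - k) - Real.log k + Real.log lam) (N : ℕ) :
    Tendsto (fun R => (∑ j ∈ Finset.range N, (ibpOp t lam)^[j] (ibpStart t lam) (slantRay k η R))
      * Complex.exp (Complex.I * t * F (slantRay k η R) lam)) atTop (nhds 0) := by
  have hdecay : Tendsto (fun R : ℝ => 4 / (1 + R) ^ 2) atTop (nhds 0) :=
    Tendsto.div_atTop tendsto_const_nhds
      ((tendsto_pow_atTop two_ne_zero).comp (tendsto_atTop_add_const_left _ 1 tendsto_id))
  have hterm : ∀ j, Tendsto (fun R => (ibpOp t lam)^[j] (ibpStart t lam) (slantRay k η R)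
      * Complex.exp (Complex.I * t * F (slantRay k η R) lam)) atTop (nhds 0) := fun j => by
    obtain ⟨K, _, hK⟩ := exists_norm_iterate_slantRay_le j
    set B := K * t⁻¹ ^ (j + 1) * ibpScale (η * k / 2) b j
    refine squeeze_zero_norm' (a := fun R => B * (4 / (1 + R) ^ 2)) ?_
      (by simpa using hdecay.const_mul B)
    filter_upwards [eventually_ge_atTop 0] with R hR
    have hamp : ‖(ibpOp t lam)^[j] (ibpStart t lam) (slantRay k η R)‖ ≤ B :=
      (le_mul_of_one_le_right (norm_nonneg _) (le_add_of_nonneg_right (norm_nonneg _))).trans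
        (hK t lam k η b (by linarith) hk0 hk1 hη hη1 hb0 hb1 hb R hR)
    rw [norm_mul]
    exact mul_le_mul hamp (norm_exp_phase_slantRay_le hk0 hk1 hη hη1 hlam (hb0.le.trans hb) ht hR)
      (norm_nonneg _) ((norm_nonneg _).trans hamp)
  simpa [Finset.sum_mul] using tendsto_finsetSum (Finset.range N) fun j _ => hterm j

theorem norm_one_add_mul_I_le {η : ℝ} (hη : |η| ≤ 1) : ‖(1 : ℂ) + η * Complex.I‖ ≤ 2 := by
  refine (norm_add_le _ _).trans ?_
  rw [norm_one, norm_mul, Complex.norm_I, mul_one, Complex.norm_real, Real.norm_eq_abs]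
  linarith

theorem exists_norm_remainder_slantRay_le (N : ℕ) : ∃ K : ℝ, 0 ≤ K ∧ ∀ t lam k η b : ℝ, 2 ≤ t →
    0 < k → k ≤ 1 / 2 → 0 < η → η ≤ 1 → -1 ≤ η * Real.log lam → 0 < b → b ≤ 1 →
    b ≤ Real.log (1 - k) - Real.log k + Real.log lam → ∀ R, 0 ≤ R →
    ‖(ibpOp t lam)^[N] (ibpStart t lam) (slantRay k η R)
        * (Complex.I * t * dF lam (slantRay k η R))
        * Complex.exp (Complex.I * t * F (slantRay k η R) lam) * (1 + η * Complex.I)‖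
      ≤ K * t⁻¹ ^ N * ibpScale (η * k / 2) b N / (1 + R) ^ 2 := by
  obtain ⟨K, hK0, hK⟩ := exists_norm_iterate_slantRay_le N
  refine ⟨8 * K, by positivity, fun t lam k η b ht2 hk0 hk1 hη hη1 hlam hb0 hb1 hb R hR => ?_⟩
  have ht : 0 < t := by linarith
  have hscale := ibpScale_nonneg (x := η * k / 2) (by positivity) hb0.le N
  set G := (ibpOp t lam)^[N] (ibpStart t lam) (slantRay k η R)
  have hGdF : ‖G‖ * ‖dF lam (slantRay k η R)‖
      ≤ K * t⁻¹ ^ (N + 1) * ibpScale (η * k / 2) b N := by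
    refine le_trans ?_ (hK t lam k η b ht hk0 hk1 hη hη1 hb0 hb1 hb R hR)
    gcongr
    exact le_add_of_nonneg_left zero_le_one
  calc ‖G * (Complex.I * t * dF lam (slantRay k η R))
          * Complex.exp (Complex.I * t * F (slantRay k η R) lam) * (1 + η * Complex.I)‖
      = t * (‖G‖ * ‖dF lam (slantRay k η R)‖)
          * ‖Complex.exp (Complex.I * t * F (slantRay k η R) lam)‖
          * ‖(1 : ℂ) + η * Complex.I‖ := by
        simp only [norm_mul, Complex.norm_I, Complex.norm_real, Real.norm_of_nonneg ht.le]
        ring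
    _ ≤ t * (K * t⁻¹ ^ (N + 1) * ibpScale (η * k / 2) b N) * (4 / (1 + R) ^ 2) * 2 := by
        gcongr
        · exact norm_exp_phase_slantRay_le hk0 hk1 hη hη1 hlam (hb0.le.trans hb) ht2 hR
        · exact norm_one_add_mul_I_le (by rwa [abs_of_pos hη])
    _ = t * t⁻¹ * (8 * K * t⁻¹ ^ N * ibpScale (η * k / 2) b N) / (1 + R) ^ 2 := by ring
    _ = 8 * K * t⁻¹ ^ N * ibpScale (η * k / 2) b N / (1 + R) ^ 2 := by
        rw [mul_inv_cancel₀ ht.ne', one_mul]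

theorem norm_sub_le_of_norm_deriv_le_div_sq {E : Type*} [NormedAddCommGroup E] [NormedSpace ℝ E]
    {f f' : ℝ → E} {M : ℝ} (hf : ∀ R, 0 ≤ R → HasDerivAt f (f' R) R)
    (hM : ∀ R, 0 ≤ R → ‖f' R‖ ≤ M / (1 + R) ^ 2) {R : ℝ} (hR : 0 ≤ R) : ‖f R - f 0‖ ≤ M := by
  have hM0 : 0 ≤ M := by simpa using (norm_nonneg _).trans (hM 0 le_rfl)
  have hB : ∀ x, 0 ≤ x → HasDerivAt (fun x => M - M * (1 + x)⁻¹) (M / (1 + x) ^ 2) x :=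
    fun x hx => by
      have hx1 : 1 + x ≠ 0 := by positivity
      refine ((((hasDerivAt_id x).const_add 1).inv hx1).const_mul M |>.const_sub M).congr_deriv ?_
      simp only [id]
      ring
  have h := image_norm_le_of_norm_deriv_right_le_deriv_boundary' (a := 0) (b := R)
    (f := fun x => f x - f 0)
    (fun x hx => ((hf x hx.1).sub_const _).continuousAt.continuousWithinAt)
    (fun x hx => ((hf x hx.1).sub_const _).hasDerivWithinAt) (by simp)
    (fun x hx => (hB x hx.1).continuousAt.continuousWithinAt)
    (fun x hx => (hB x hx.1).hasDerivWithinAt) (fun x hx => hM x hx.1) (Set.right_mem_Icc.2 hR)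
  exact h.trans (sub_le_self _ (by positivity))

theorem sum_T (t lam k : ℝ) (N : ℕ) :
    ∑ j ∈ Finset.range N, T t lam k j
      = -((∑ j ∈ Finset.range N, (ibpOp t lam)^[j] (ibpStart t lam) (1 - k))
        * Complex.exp (Complex.I * t * F (1 - k) lam)) := by
  simp only [T, neg_mul, Finset.sum_neg_distrib, Finset.sum_mul]

theorem exists_norm_tail_le (N : ℕ) : ∃ K : ℝ, 0 ≤ K ∧ ∀ t lam k η b : ℝ, 2 ≤ t →
    0 < k → k ≤ 1 / 2 → 0 < η → η ≤ 1 → -1 ≤ η * Real.log lam → 0 < b → b ≤ 1 →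
    b ≤ Real.log (1 - k) - Real.log k + Real.log lam → ∀ (g : ℂ → ℂ) (L : ℂ),
    (∀ R, 0 ≤ R → HasDerivAt g (halfIntegrand t lam (slantRay k η R)) (slantRay k η R)) →
    Tendsto (fun R => g (slantRay k η R)) atTop (nhds L) →
    ‖L - g ((1 - k : ℝ) : ℂ) - ∑ j ∈ Finset.range N, T t lam k j‖
      ≤ K * t⁻¹ ^ N * ibpScale (η * k / 2) b N := by
  obtain ⟨K, hK0, hK⟩ := exists_norm_remainder_slantRay_le N
  refine ⟨K, hK0, fun t lam k η b ht hk0 hk1 hη hη1 hlam hb0 hb1 hb g L hg hL => ?_⟩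
  set S : ℂ → ℂ := fun z => (∑ j ∈ Finset.range N, (ibpOp t lam)^[j] (ibpStart t lam) z)
    * Complex.exp (Complex.I * t * F z lam) with hS
  have hderiv : ∀ R, 0 ≤ R → HasDerivAt (fun R => g (slantRay k η R) - S (slantRay k η R))
      ((ibpOp t lam)^[N] (ibpStart t lam) (slantRay k η R)
        * (Complex.I * t * dF lam (slantRay k η R))
        * Complex.exp (Complex.I * t * F (slantRay k η R) lam) * (1 + η * Complex.I)) R :=
    fun R hR => by
      have hsum := hasDerivAt_sum_ibp (show t ≠ 0 by linarith) N
        (slantRay_mem_regularSet hk0 (by linarith) hη hη1 hb0 hb1 hb hR)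
      refine (((hg R hR).sub hsum).comp R (hasDerivAt_ray (1 - k) _ R)).congr_deriv ?_
      rw [halfIntegrand, sub_sub_cancel]
  have hSlim : Tendsto (fun R => S (slantRay k η R)) atTop (nhds 0) :=
    tendsto_sum_ibp_slantRay ht hk0 hk1 hη hη1 hlam hb0 hb1 hb N
  have hle := le_of_tendsto
    ((hL.sub hSlim).sub_const (g (slantRay k η 0) - S (slantRay k η 0))).norm (by
      filter_upwards [eventually_ge_atTop 0] with R hR
      exact norm_sub_le_of_norm_deriv_le_div_sq hderiv
        (hK t lam k η b ht hk0 hk1 hη hη1 hlam hb0 hb1 hb) hR)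
  refine le_trans (le_of_eq ?_) hle
  rw [sum_T, slantRay_zero, hS, Complex.ofReal_sub, Complex.ofReal_one]
  congr 1
  ring

theorem norm_exp_phase_ofReal {x : ℝ} (h0 : 0 ≤ x) (h1 : x ≤ 1) (t lam : ℝ) :
    ‖Complex.exp (Complex.I * t * F x lam)‖ = 1 := by
  rw [norm_exp_phase, F_ofReal h0 h1, Complex.ofReal_im, mul_zero, neg_zero, Real.exp_zero]

theorem exists_norm_T_le (j : ℕ) : ∃ K : ℝ, 0 ≤ K ∧ ∀ t lam k b : ℝ, 0 < t →
    0 < k → k ≤ 1 / 2 → 0 < b → b ≤ 1 →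
    b ≤ Real.log (1 - k) - Real.log k + Real.log lam →
    ‖T t lam k j‖ ≤ t⁻¹ ^ (j + 1) * (ibpScale k b j
      * ((1 - k)⁻¹ ^ j * (Nat.doubleFactorial (2 * j - 1) : ℝ) + K * b)) := by
  obtain ⟨K, hK0, hK⟩ := exists_norm_ibpClosed_le_leading j
  refine ⟨K, hK0, fun t lam k b ht hk0 hk1 hb0 hb1 hb => ?_⟩
  have hcast : (1 : ℂ) - k = ((1 - k : ℝ) : ℂ) := by push_cast; rfl
  have hnorm : ‖((1 - k : ℝ) : ℂ)‖ = 1 - k := Complex.norm_of_nonneg (by linarith)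
  have hnorm' : ‖1 - ((1 - k : ℝ) : ℂ)‖ = k := by
    rw [← hcast, sub_sub_cancel, Complex.norm_of_nonneg hk0.le]
  have hmem : ((1 - k : ℝ) : ℂ) ∈ cutPlane := ofReal_mem_cutPlane (by linarith) (by linarith)
  have hdF : b ≤ ‖dF lam ((1 - k : ℝ) : ℂ)‖ :=
    hb.trans ((le_re_dF hmem (by linarith) le_rfl hnorm'.le lam).trans (Complex.re_le_norm _))
  have hbound := hK lam b _ (by rw [hnorm]; linarith) hb0 hb1 hdF
  rw [hnorm, hnorm'] at hbound
  rw [T, hcast, norm_mul, norm_neg, norm_exp_phase_ofReal (by linarith) (by linarith), mul_one,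
    norm_iterate_ibpOp ht j ⟨hmem, norm_pos_iff.1 (hb0.trans_le hdF)⟩]
  exact mul_le_mul_of_nonneg_left hbound (by positivity)

end Tail

section Magnitudes

variable {δ t a : ℝ}

theorem boundT_eq (ht : 0 < t) (ha : 0 < a) (j : ℕ) :
    boundT δ j t a = (Nat.doubleFactorial (2 * j - 1) : ℝ)
      * (t ^ (-(1 / 2) : ℝ) * (a * t ^ (δ / 2))⁻¹ ^ (2 * j + 1)) := by
  obtain ⟨u, rfl⟩ : ∃ u, t = Real.exp u := ⟨Real.log t, (Real.exp_log ht).symm⟩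
  obtain ⟨v, rfl⟩ : ∃ v, a = Real.exp v := ⟨Real.log a, (Real.exp_log ha).symm⟩
  rw [boundT, mul_assoc]
  congr 1
  simp only [← Real.exp_mul, ← Real.exp_add, ← Real.exp_neg, ← Real.exp_nat_mul]
  congr 1
  push_cast
  ring

theorem inv_pow_mul_ibpScale (ht : 0 < t) (ha : 0 < a) (j : ℕ) :
    t⁻¹ ^ (j + 1) * ibpScale (t ^ (δ - 1)) a j
      = t ^ (-(1 / 2) : ℝ) * (a * t ^ (δ / 2))⁻¹ ^ (2 * j + 1) := by
  obtain ⟨u, rfl⟩ : ∃ u, t = Real.exp u := ⟨Real.log t, (Real.exp_log ht).symm⟩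
  obtain ⟨v, rfl⟩ : ∃ v, a = Real.exp v := ⟨Real.log a, (Real.exp_log ha).symm⟩
  simp only [ibpScale, ← Real.exp_mul, ← Real.exp_add, ← Real.exp_neg, ← Real.exp_nat_mul]
  congr 1
  push_cast
  ring

theorem err₁_eq (ht : 0 < t) (ha : 0 < a) {m : ℕ} (hm : 1 ≤ m) :
    err₁ δ m t a = (Nat.doubleFactorial (4 * m - 5) : ℝ)
      * (t ^ (-(1 / 2) : ℝ) * t ^ (δ / 2) * (a * t ^ (δ / 2))⁻¹ ^ (4 * m - 4))
      * Real.log t ^ ((4 * (m : ℝ) - 3) / 2) := by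
  rw [err₁, mul_right_comm, mul_assoc (Nat.doubleFactorial (4 * m - 5) : ℝ)]
  congr 2
  obtain ⟨u, rfl⟩ : ∃ u, t = Real.exp u := ⟨Real.log t, (Real.exp_log ht).symm⟩
  obtain ⟨v, rfl⟩ : ∃ v, a = Real.exp v := ⟨Real.log a, (Real.exp_log ha).symm⟩
  simp only [← Real.exp_mul, ← Real.exp_add, ← Real.exp_neg, ← Real.exp_nat_mul]
  congr 1
  rw [Nat.cast_sub (by omega)]
  push_cast
  ring

theorem err₂_eq (ht : 0 < t) :
    err₂ δ t a = Real.sqrt (t ^ (δ - 1)) * (t * t ^ (δ - 1)) * a ^ 4 := by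
  rw [err₂, Real.sqrt_eq_rpow]
  congr 1
  obtain ⟨u, rfl⟩ : ∃ u, t = Real.exp u := ⟨Real.log t, (Real.exp_log ht).symm⟩
  simp only [← Real.exp_mul, ← Real.exp_add]
  congr 1
  ring

theorem mul_rpow_mul_sq (ht : 0 < t) (a : ℝ) :
    t * t ^ (δ - 1) * a ^ 2 = (a * t ^ (δ / 2)) ^ 2 := by
  rw [mul_pow, mul_comm (a ^ 2)]
  congr 1
  obtain ⟨u, rfl⟩ : ∃ u, t = Real.exp u := ⟨Real.log t, (Real.exp_log ht).symm⟩
  simp only [← Real.exp_mul, ← Real.exp_add, ← Real.exp_nat_mul]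
  congr 1
  push_cast
  ring

theorem sqrt_mul_le_err₂ (ht : 0 < t) (hone : 1 ≤ a * t ^ (δ / 2)) :
    Real.sqrt (t ^ (δ - 1)) * (a ^ 2 + 8 * (t * t ^ (δ - 1)) * a ^ 4) ≤ 9 * err₂ δ t a := by
  have hsq : a ^ 2 ≤ t * t ^ (δ - 1) * a ^ 4 := by
    have hsq1 : 1 ≤ t * t ^ (δ - 1) * a ^ 2 := (mul_rpow_mul_sq ht a).symm ▸ one_le_pow₀ hone
    nlinarith [mul_le_mul_of_nonneg_right hsq1 (sq_nonneg a)]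
  calc Real.sqrt (t ^ (δ - 1)) * (a ^ 2 + 8 * (t * t ^ (δ - 1)) * a ^ 4)
      ≤ Real.sqrt (t ^ (δ - 1))
          * (t * t ^ (δ - 1) * a ^ 4 + 8 * (t * t ^ (δ - 1)) * a ^ 4) := by gcongr
    _ = 9 * err₂ δ t a := by rw [err₂_eq ht]; ring

end Magnitudes

section SplitPoint

variable {δ t a lam : ℝ}

theorem lamC_pos (ht : 0 < t) (hp : t ^ (δ - 1) < 1) : 0 < lamC δ t :=
  div_pos (Real.rpow_pos_of_pos ht _) (sub_pos.2 hp)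

theorem log_lamC_le (ht : 0 < t) (hp : t ^ (δ - 1) < 1) (hlam : lamC δ t ≤ lam) :
    Real.log (t ^ (δ - 1)) - Real.log (1 - t ^ (δ - 1)) ≤ Real.log lam := by
  rw [← Real.log_div (Real.rpow_pos_of_pos ht _).ne' (by linarith)]
  exact Real.log_le_log (lamC_pos ht hp) hlam

theorem neg_one_le_inv_log_mul_log (hδ : 0 ≤ δ) (ht : 1 < t) (hp : t ^ (δ - 1) < 1)
    (hlam : lamC δ t ≤ lam) : -1 ≤ (Real.log t)⁻¹ * Real.log lam := by
  have hL : 0 < Real.log t := Real.log_pos ht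
  have hp0 : 0 < t ^ (δ - 1) := Real.rpow_pos_of_pos (by linarith) _
  have hlog := log_lamC_le (by linarith) hp hlam
  have hneg := Real.log_nonpos (show 0 ≤ 1 - t ^ (δ - 1) by linarith) (by linarith)
  rw [Real.log_rpow (by linarith)] at hlog
  rw [le_inv_mul_iff₀ hL]
  nlinarith

theorem splitK_pos (ht : 0 < t) (ha : a < 1) : 0 < splitK δ t a :=
  mul_pos (Real.rpow_pos_of_pos ht _) (sub_pos.2 ha)

theorem splitK_le (ht : 0 < t) (ha : 0 ≤ a) : splitK δ t a ≤ t ^ (δ - 1) :=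
  mul_le_of_le_one_right (Real.rpow_pos_of_pos ht _).le (by linarith)

theorem le_log_splitK (ht : 0 < t) (hp : t ^ (δ - 1) < 1) (ha0 : 0 ≤ a) (ha1 : a < 1)
    (hlam : lamC δ t ≤ lam) :
    a ≤ Real.log (1 - splitK δ t a) - Real.log (splitK δ t a) + Real.log lam := by
  have hlog := log_lamC_le ht hp hlam
  have hsplit : Real.log (splitK δ t a) = Real.log (t ^ (δ - 1)) + Real.log (1 - a) :=
    Real.log_mul (Real.rpow_pos_of_pos ht _).ne' (by linarith)
  have hmono : Real.log (1 - t ^ (δ - 1)) ≤ Real.log (1 - splitK δ t a) :=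
    Real.log_le_log (by linarith) (by linarith [splitK_le (δ := δ) ht ha0])
  have hlin := Real.log_le_sub_one_of_pos (show 0 < 1 - a by linarith)
  linarith

end SplitPoint

section LargeTime

theorem tendsto_rpow_sub_one {δ : ℝ} (hδ1 : δ < 1) :
    Tendsto (fun t : ℝ => t ^ (δ - 1)) atTop (nhds 0) := by
  simpa using tendsto_rpow_neg_atTop (show 0 < 1 - δ by linarith)

theorem tendsto_zero_of_isBigO {δ : ℝ} (hδ0 : 0 < δ) {m : ℕ} (hm : 2 ≤ m) {a : ℝ → ℝ}
    (hO : a =O[atTop] (fun t : ℝ => t ^ (-(δ / 2) + δ / (4 * (m : ℝ) - 2)))) :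
    Tendsto a atTop (nhds 0) := by
  refine hO.trans_tendsto ?_
  have hm' : (2 : ℝ) ≤ m := by exact_mod_cast hm
  have hlt : δ / (4 * (m : ℝ) - 2) < δ / 2 := div_lt_div_of_pos_left hδ0 two_pos (by linarith)
  refine (tendsto_rpow_neg_atTop (sub_pos.2 hlt)).congr fun t => ?_
  congr 1
  ring

theorem eventually_rpow_le_mul {δ γ γ' : ℝ} (hγ : γ < γ') {a : ℝ → ℝ}
    (ha : ∀ᶠ t in atTop, 0 < a t) (hO : (fun t : ℝ => t ^ (γ' - δ / 2)) =O[atTop] a) :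
    ∀ᶠ t in atTop, t ^ γ ≤ a t * t ^ (δ / 2) := by
  obtain ⟨c, hc0, hc⟩ := hO.exists_pos
  filter_upwards [ha, hc.bound, eventually_gt_atTop 0,
    (tendsto_rpow_atTop (sub_pos.2 hγ)).eventually_ge_atTop c] with t hat hct ht hct'
  rw [Real.norm_of_nonneg hat.le, Real.norm_of_nonneg (by positivity)] at hct
  refine le_of_mul_le_mul_left ?_ hc0
  calc c * t ^ γ ≤ t ^ (γ' - γ) * t ^ γ := by gcongr
    _ = t ^ (γ' - δ / 2) * t ^ (δ / 2) := by
      rw [← Real.rpow_add ht, ← Real.rpow_add ht]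
      ring_nf
    _ ≤ c * a t * t ^ (δ / 2) := by gcongr
    _ = c * (a t * t ^ (δ / 2)) := mul_assoc _ _ _

theorem tendsto_splitK {δ : ℝ} (hδ1 : δ < 1) {a : ℝ → ℝ} (ha0 : Tendsto a atTop (nhds 0)) :
    Tendsto (fun t => splitK δ t (a t)) atTop (nhds 0) := by
  simpa [splitK] using (tendsto_rpow_sub_one hδ1).mul (ha0.const_sub 1)

theorem tendsto_T_factor {δ : ℝ} (hδ1 : δ < 1) {a : ℝ → ℝ} (ha0 : Tendsto a atTop (nhds 0))
    (K d : ℝ) (j : ℕ) :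
    Tendsto (fun t => (1 - a t) ^ (-(1 / 2) : ℝ) * (1 - a t)⁻¹ ^ j
      * ((1 - splitK δ t (a t))⁻¹ ^ j * d + K * a t)) atTop (nhds d) := by
  have ha1 : Tendsto (fun t => 1 - a t) atTop (nhds 1) := by simpa using ha0.const_sub 1
  have hk1 : Tendsto (fun t => 1 - splitK δ t (a t)) atTop (nhds 1) := by
    simpa using (tendsto_splitK hδ1 ha0).const_sub 1
  simpa using ((ha1.rpow_const (p := -(1 / 2)) (Or.inl one_ne_zero)).mul
    ((ha1.inv₀ one_ne_zero).pow j)).mul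
      ((((hk1.inv₀ one_ne_zero).pow j).mul_const d).add (ha0.const_mul K))

theorem eventually_norm_T_le {δ : ℝ} (hδ1 : δ < 1) {a : ℝ → ℝ} (ha : ∀ᶠ t in atTop, 0 < a t)
    (ha0 : Tendsto a atTop (nhds 0)) (j : ℕ) :
    ∀ᶠ t in atTop, ∀ lam : ℝ, lamC δ t ≤ lam →
      ‖T t lam (splitK δ t (a t)) j‖ ≤ 2 * boundT δ j t (a t) := by
  obtain ⟨K, _, hK⟩ := exists_norm_T_le j
  set d : ℝ := (Nat.doubleFactorial (2 * j - 1) : ℝ)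
  have hd : d < 2 * d :=
    lt_two_mul_self (Nat.cast_pos.2 (Nat.doubleFactorial_pos _))
  filter_upwards [ha, ha0.eventually_le_const one_half_pos,
    (tendsto_rpow_sub_one hδ1).eventually_le_const one_half_pos, eventually_gt_atTop 0,
    (tendsto_T_factor hδ1 ha0 K d j).eventually_le_const hd] with t hat hat1 hp ht hfac lam hlam
  have hp0 : 0 < t ^ (δ - 1) := Real.rpow_pos_of_pos ht _
  have hk := splitK_le (δ := δ) ht hat.le
  have hscale := ibpScale_nonneg hp0.le hat.le j
  calc ‖T t lam (splitK δ t (a t)) j‖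
      ≤ t⁻¹ ^ (j + 1) * (ibpScale (splitK δ t (a t)) (a t) j
        * ((1 - splitK δ t (a t))⁻¹ ^ j * d + K * a t)) :=
        hK t lam _ (a t) ht (splitK_pos ht (by linarith)) (hk.trans hp) hat (by linarith)
          (le_log_splitK ht (by linarith) hat.le (by linarith) hlam)
    _ = t⁻¹ ^ (j + 1) * ibpScale (t ^ (δ - 1)) (a t) j * ((1 - a t) ^ (-(1 / 2) : ℝ)
          * (1 - a t)⁻¹ ^ j * ((1 - splitK δ t (a t))⁻¹ ^ j * d + K * a t)) := by
        nth_rewrite 1 [splitK]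
        rw [ibpScale_mul hp0.le (by linarith)]
        ring
    _ ≤ t⁻¹ ^ (j + 1) * ibpScale (t ^ (δ - 1)) (a t) j * (2 * d) := by gcongr
    _ = 2 * boundT δ j t (a t) := by
        rw [inv_pow_mul_ibpScale ht hat, boundT_eq ht hat]
        ring

theorem eventually_mul_log_pow_le (c : ℝ) (n : ℕ) :
    ∀ᶠ t : ℝ in atTop, c * Real.log t ^ n ≤ t := by
  filter_upwards [((Real.isLittleO_pow_log_id_atTop (n := n)).const_mul_left c).bound one_pos,
    eventually_ge_atTop 0] with t hbound ht
  simpa [abs_of_nonneg ht] using (le_abs_self _).trans hbound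

theorem ibpScale_le_inv_pow {x b : ℝ} (hx0 : 0 < x) (hx1 : x ≤ 1) (hb : 0 ≤ b) (j : ℕ) :
    ibpScale x b j ≤ x⁻¹ ^ (j + 1) * b⁻¹ ^ (2 * j + 1) := by
  have hroot : x ^ (-(1 / 2) : ℝ) ≤ x⁻¹ := by
    rw [← Real.rpow_neg_one]
    exact Real.rpow_le_rpow_of_exponent_ge hx0 hx1 (by norm_num)
  rw [ibpScale, pow_succ' x⁻¹ j]
  gcongr

theorem inv_pow_mul_inv_pow {δ t a : ℝ} (ht : 0 < t) (n : ℕ) :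
    t⁻¹ ^ n * (t ^ (δ - 1))⁻¹ ^ n * a⁻¹ ^ (2 * n) = (a * t ^ (δ / 2))⁻¹ ^ (2 * n) := by
  rw [pow_mul, pow_mul, inv_pow (a * _), ← mul_rpow_mul_sq ht]
  simp only [inv_pow, mul_inv, mul_pow]

theorem mul_inv_pow_le_of_le_pow {y c : ℝ} (hy : 0 < y) {n l : ℕ} (hc : c ≤ y ^ l) :
    c * y⁻¹ ^ (n + l) ≤ y⁻¹ ^ n := by
  calc c * y⁻¹ ^ (n + l) ≤ y ^ l * y⁻¹ ^ (n + l) := by gcongr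
    _ = y⁻¹ ^ n * (y * y⁻¹) ^ l := by ring
    _ = y⁻¹ ^ n := by rw [mul_inv_cancel₀ hy.ne', one_pow, mul_one]

end LargeTime

section Remainder

variable {δ t a : ℝ}

theorem ibpScale_splitK_le (ht : 0 < t) (hp : t ^ (δ - 1) ≤ 1) (hL : 1 ≤ Real.log t)
    (ha : a ≤ 1 / 2) {b : ℝ} (hb : 0 ≤ b) (j : ℕ) :
    ibpScale ((Real.log t)⁻¹ * splitK δ t a / 2) b j
      ≤ (4 * Real.log t * (t ^ (δ - 1))⁻¹) ^ (j + 1) * b⁻¹ ^ (2 * j + 1) := by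
  have hp0 : 0 < t ^ (δ - 1) := Real.rpow_pos_of_pos ht _
  have hone : 1 ≤ 4 * Real.log t * (t ^ (δ - 1))⁻¹ :=
    one_le_mul_of_one_le_of_one_le (by linarith) ((one_le_inv₀ hp0).2 hp)
  have hle : (4 * Real.log t * (t ^ (δ - 1))⁻¹)⁻¹ ≤ (Real.log t)⁻¹ * splitK δ t a / 2 := by
    calc (4 * Real.log t * (t ^ (δ - 1))⁻¹)⁻¹
        = (Real.log t)⁻¹ * (t ^ (δ - 1) * (1 - 1 / 2)) / 2 := by
          rw [mul_inv, mul_inv, inv_inv]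
          ring
      _ ≤ (Real.log t)⁻¹ * (t ^ (δ - 1) * (1 - a)) / 2 := by gcongr
  calc ibpScale ((Real.log t)⁻¹ * splitK δ t a / 2) b j
      ≤ ibpScale (4 * Real.log t * (t ^ (δ - 1))⁻¹)⁻¹ b j :=
        ibpScale_anti (inv_pos.2 (by linarith)) hle hb j
    _ ≤ (4 * Real.log t * (t ^ (δ - 1))⁻¹) ^ (j + 1) * b⁻¹ ^ (2 * j + 1) := by
        simpa only [inv_inv] using
          ibpScale_le_inv_pow (inv_pos.2 (by linarith)) (inv_le_one_of_one_le₀ hone) hb j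

theorem mul_ibpScale_splitK_le (hδ0 : 0 ≤ δ) (hδ1 : δ ≤ 1) (ht : 1 ≤ t)
    (hL : 1 ≤ Real.log t) (ha0 : 0 < a) (ha1 : a ≤ 1 / 2) (hone : 1 ≤ a * t ^ (δ / 2))
    {K : ℝ} (hK : 0 ≤ K) {N : ℕ} (hlog : K * 4 ^ (N + 1) * Real.log t ^ (N + 1) ≤ t) :
    K * t⁻¹ ^ N * ibpScale ((Real.log t)⁻¹ * splitK δ t a / 2) a N
      ≤ t ^ 3 * (a * t ^ (δ / 2))⁻¹ ^ (2 * N) := by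
  have ht0 : 0 < t := by linarith
  have hp : t ^ (δ - 1) ≤ 1 := Real.rpow_le_one_of_one_le_of_nonpos ht (by linarith)
  have hpinv : (t ^ (δ - 1))⁻¹ ≤ t := by
    rw [← Real.rpow_neg ht0.le]
    exact Real.rpow_le_self_of_one_le ht (by linarith)
  have hainv : a⁻¹ ≤ t := by
    rw [inv_le_iff_one_le_mul₀' ha0]
    exact hone.trans (by gcongr; exact Real.rpow_le_self_of_one_le ht (by linarith))
  calc K * t⁻¹ ^ N * ibpScale ((Real.log t)⁻¹ * splitK δ t a / 2) a N
      ≤ K * t⁻¹ ^ N * ((4 * Real.log t * (t ^ (δ - 1))⁻¹) ^ (N + 1) * a⁻¹ ^ (2 * N + 1)) := by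
        gcongr
        exact ibpScale_splitK_le ht0 hp hL ha1 ha0.le N
    _ = (K * 4 ^ (N + 1) * Real.log t ^ (N + 1)) * (t ^ (δ - 1))⁻¹ * a⁻¹
          * (t⁻¹ ^ N * (t ^ (δ - 1))⁻¹ ^ N * a⁻¹ ^ (2 * N)) := by ring
    _ ≤ t * t * t * (t⁻¹ ^ N * (t ^ (δ - 1))⁻¹ ^ N * a⁻¹ ^ (2 * N)) := by gcongr
    _ = t ^ 3 * (a * t ^ (δ / 2))⁻¹ ^ (2 * N) := by
        rw [inv_pow_mul_inv_pow ht0]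
        ring

theorem pow_mul_inv_pow_le {γ y : ℝ} (ht : 1 ≤ t) (hy : t ^ γ ≤ y) {n l : ℕ}
    (hl : 4 ≤ γ * l) : t ^ 3 * y⁻¹ ^ (n + l) ≤ t ^ (-(1 / 2) : ℝ) * y⁻¹ ^ n := by
  have ht0 : 0 < t := by linarith
  have hy0 : 0 < y := (Real.rpow_pos_of_pos ht0 γ).trans_le hy
  have hpow : t ^ (4 : ℝ) ≤ y ^ l := by
    calc t ^ (4 : ℝ) ≤ t ^ (γ * l) := Real.rpow_le_rpow_of_exponent_le ht hl
      _ = (t ^ γ) ^ l := Real.rpow_mul_natCast ht0.le γ l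
      _ ≤ y ^ l := by gcongr
  calc t ^ 3 * y⁻¹ ^ (n + l) ≤ t ^ (-(1 / 2) : ℝ) * t ^ (4 : ℝ) * y⁻¹ ^ (n + l) := by
        gcongr
        rw [← Real.rpow_add ht0, ← Real.rpow_natCast]
        exact Real.rpow_le_rpow_of_exponent_le ht (by norm_num)
    _ ≤ t ^ (-(1 / 2) : ℝ) * y⁻¹ ^ n := by
        rw [mul_assoc]
        gcongr
        exact mul_inv_pow_le_of_le_pow hy0 hpow

theorem norm_sum_Ico_le {lam k : ℝ} (ht : 0 < t) (ha : 0 < a) (hone : 1 ≤ a * t ^ (δ / 2))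
    {n N : ℕ} (hT : ∀ j ∈ Finset.Ico n N, ‖T t lam k j‖ ≤ 2 * boundT δ j t a) :
    ‖∑ j ∈ Finset.Ico n N, T t lam k j‖
      ≤ (∑ j ∈ Finset.Ico n N, 2 * (Nat.doubleFactorial (2 * j - 1) : ℝ))
        * (t ^ (-(1 / 2) : ℝ) * (a * t ^ (δ / 2))⁻¹ ^ (2 * n + 1)) := by
  rw [Finset.sum_mul]
  refine norm_sum_le_of_le _ fun j hj => (hT j hj).trans ?_
  rw [boundT_eq ht ha, ← mul_assoc]
  gcongr ?_ * (_ * ?_)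
  exact pow_le_pow_of_le_one (by positivity) (inv_le_one_of_one_le₀ hone)
    (by have := (Finset.mem_Ico.1 hj).1; omega)

end Remainder

-- The remainder bound after `N` integrations by parts loses powers of `t` and `log t`, so the
-- expansion is carried to a large `N` and the boundary terms from the `n`-th on are then
-- estimated one by one.
theorem exists_eventually_norm_tail_le {δ γ : ℝ} (hδ0 : 0 ≤ δ) (hδ1 : δ < 1) (hγ : 0 < γ)
    {a : ℝ → ℝ} (ha : ∀ᶠ t in atTop, 0 < a t) (ha0 : Tendsto a atTop (nhds 0))
    (hgrowth : ∀ᶠ t in atTop, t ^ γ ≤ a t * t ^ (δ / 2)) (n : ℕ) :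
    ∃ M, 0 ≤ M ∧ ∀ᶠ t in atTop, ∀ lam, lamC δ t ≤ lam → ∀ (g : ℂ → ℂ) (L : ℂ),
      (∀ R, 0 ≤ R → HasDerivAt g
        (halfIntegrand t lam (slantRay (splitK δ t (a t)) (Real.log t)⁻¹ R))
        (slantRay (splitK δ t (a t)) (Real.log t)⁻¹ R)) →
      Tendsto (fun R => g (slantRay (splitK δ t (a t)) (Real.log t)⁻¹ R)) atTop (nhds L) →
      ‖L - g ((1 - splitK δ t (a t) : ℝ) : ℂ)
          - ∑ j ∈ Finset.range n, T t lam (splitK δ t (a t)) j‖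
        ≤ M * (t ^ (-(1 / 2) : ℝ) * (a t * t ^ (δ / 2))⁻¹ ^ (2 * n + 1)) := by
  obtain ⟨r, hr⟩ := exists_nat_ge (4 / γ)
  have hγr : 4 ≤ γ * (2 * r + 1 : ℕ) := by
    rw [div_le_iff₀' hγ] at hr
    push_cast
    nlinarith [Nat.cast_nonneg (α := ℝ) r]
  obtain ⟨K, hK0, hK⟩ := exists_norm_tail_le (n + (r + 1))
  refine ⟨1 + ∑ j ∈ Finset.Ico n (n + (r + 1)), 2 * (Nat.doubleFactorial (2 * j - 1) : ℝ),
    by positivity, ?_⟩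
  filter_upwards [ha, ha0.eventually_le_const one_half_pos,
    (tendsto_rpow_sub_one hδ1).eventually_le_const one_half_pos,
    Real.tendsto_log_atTop.eventually_ge_atTop 1, eventually_ge_atTop 2, hgrowth,
    eventually_mul_log_pow_le (K * 4 ^ (n + (r + 1) + 1)) (n + (r + 1) + 1),
    (eventually_all_finset (Finset.Ico n (n + (r + 1)))).2
      fun j _ => eventually_norm_T_le hδ1 ha ha0 j]
    with t hat hat1 hp hL ht hgrow hlog hT lam hlam g L hg hgL
  have ht1 : 1 ≤ t := by linarith
  have hone : 1 ≤ a t * t ^ (δ / 2) := (Real.one_le_rpow ht1 hγ.le).trans hgrow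
  have htail := hK t lam (splitK δ t (a t)) (Real.log t)⁻¹ (a t) ht
    (splitK_pos (by linarith) (by linarith)) ((splitK_le (by linarith) hat.le).trans hp)
    (inv_pos.2 (by linarith)) (inv_le_one_of_one_le₀ hL)
    (neg_one_le_inv_log_mul_log hδ0 (by linarith) (by linarith) hlam) hat (by linarith)
    (le_log_splitK (by linarith) (by linarith) hat.le (by linarith) hlam) g L hg hgL
  have hrem := mul_ibpScale_splitK_le hδ0 hδ1.le ht1 hL hat hat1 hone hK0 hlog
  rw [show 2 * (n + (r + 1)) = 2 * n + 1 + (2 * r + 1) by ring] at hrem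
  have hmid := norm_sum_Ico_le (by linarith) hat hone fun j hj => hT j hj lam hlam
  rw [← Finset.sum_range_add_sum_Ico _ (Nat.le_add_right n (r + 1)), ← sub_sub] at htail
  rw [add_mul, one_mul]
  refine (norm_le_norm_sub_add _ _).trans (add_le_add (htail.trans ?_) hmid)
  exact hrem.trans (pow_mul_inv_pow_le ht1 hgrow hγr)

section FirstError

theorem pow_le_of_le_rpow {δ t y c : ℝ} (ht : 0 < t) (hy0 : 0 ≤ y) {m : ℕ} (hm : 1 ≤ m)
    (hy : y ≤ c * t ^ (δ / (4 * (m : ℝ) - 2))) :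
    y ^ (2 * m - 1) ≤ c ^ (2 * m - 1) * t ^ (δ / 2) := by
  have hm' : (1 : ℝ) ≤ m := by exact_mod_cast hm
  have hne : 4 * (m : ℝ) - 2 ≠ 0 := by linarith
  calc y ^ (2 * m - 1) ≤ (c * t ^ (δ / (4 * (m : ℝ) - 2))) ^ (2 * m - 1) := by gcongr
    _ = c ^ (2 * m - 1) * t ^ (δ / 2) := by
      rw [mul_pow, ← Real.rpow_mul_natCast ht.le, Nat.cast_sub (by omega)]
      congr 2
      push_cast
      field_simp
      ring

theorem mul_le_err₁ {δ t a c M : ℝ} (ht : 0 < t) (ha : 0 < a) {m : ℕ} (hm : 2 ≤ m) (hM : 0 ≤ M)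
    (hup : a * t ^ (δ / 2) ≤ c * t ^ (δ / (4 * (m : ℝ) - 2))) (hL : 1 ≤ Real.log t)
    (hcL : M * c ^ (2 * m - 1) ≤ Real.log t) :
    M * (t ^ (-(1 / 2) : ℝ) * (a * t ^ (δ / 2))⁻¹ ^ (2 * (m - 2) + 1)) ≤ err₁ δ m t a := by
  have hy0 : 0 < a * t ^ (δ / 2) := by positivity
  have hm' : (2 : ℝ) ≤ m := by exact_mod_cast hm
  have hfac : (1 : ℝ) ≤ Nat.doubleFactorial (4 * m - 5) :=
    Nat.one_le_cast.2 (Nat.doubleFactorial_pos _)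
  have hlog : Real.log t ≤ Real.log t ^ ((4 * (m : ℝ) - 3) / 2) :=
    Real.self_le_rpow_of_one_le hL (by linarith)
  have hinv : (a * t ^ (δ / 2))⁻¹ ^ (2 * (m - 2) + 1)
      = (a * t ^ (δ / 2)) ^ (2 * m - 1) * (a * t ^ (δ / 2))⁻¹ ^ (4 * m - 4) := by
    rw [show 4 * m - 4 = (2 * m - 1) + (2 * (m - 2) + 1) by omega,
      pow_add _ (2 * m - 1), ← mul_assoc, ← mul_pow, mul_inv_cancel₀ hy0.ne', one_pow, one_mul]
  rw [err₁_eq ht ha (by omega), hinv]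
  calc M * (t ^ (-(1 / 2) : ℝ)
        * ((a * t ^ (δ / 2)) ^ (2 * m - 1) * (a * t ^ (δ / 2))⁻¹ ^ (4 * m - 4)))
      ≤ M * (t ^ (-(1 / 2) : ℝ)
        * (c ^ (2 * m - 1) * t ^ (δ / 2) * (a * t ^ (δ / 2))⁻¹ ^ (4 * m - 4))) := by
        gcongr
        exact pow_le_of_le_rpow ht hy0.le (by omega) hup
    _ = 1 * (t ^ (-(1 / 2) : ℝ) * t ^ (δ / 2) * (a * t ^ (δ / 2))⁻¹ ^ (4 * m - 4))
        * (M * c ^ (2 * m - 1)) := by ring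
    _ ≤ 1 * (t ^ (-(1 / 2) : ℝ) * t ^ (δ / 2) * (a * t ^ (δ / 2))⁻¹ ^ (4 * m - 4))
        * Real.log t ^ ((4 * (m : ℝ) - 3) / 2) := by
        gcongr
        exact hcL.trans hlog
    _ ≤ _ := by gcongr

theorem eventually_mul_le_err₁ {δ : ℝ} {m : ℕ} (hm : 2 ≤ m) {a : ℝ → ℝ}
    (ha : ∀ᶠ t in atTop, 0 < a t)
    (hO : a =O[atTop] (fun t : ℝ => t ^ (-(δ / 2) + δ / (4 * (m : ℝ) - 2)))) {M : ℝ}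
    (hM : 0 ≤ M) :
    ∀ᶠ t in atTop, M * (t ^ (-(1 / 2) : ℝ) * (a t * t ^ (δ / 2))⁻¹ ^ (2 * (m - 2) + 1))
      ≤ err₁ δ m t (a t) := by
  obtain ⟨c, hc⟩ := hO.bound
  filter_upwards [ha, hc, eventually_gt_atTop 0,
    Real.tendsto_log_atTop.eventually_ge_atTop 1,
    Real.tendsto_log_atTop.eventually_ge_atTop (M * c ^ (2 * m - 1))] with t hat hct ht hL hcL
  rw [Real.norm_of_nonneg hat.le, Real.norm_of_nonneg (by positivity)] at hct
  refine mul_le_err₁ ht hat hm hM ?_ hL hcL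
  calc a t * t ^ (δ / 2)
      ≤ c * t ^ (-(δ / 2) + δ / (4 * (m : ℝ) - 2)) * t ^ (δ / 2) := by gcongr
    _ = c * t ^ (δ / (4 * (m : ℝ) - 2)) := by
      rw [mul_assoc, ← Real.rpow_add ht]
      ring_nf

end FirstError

theorem isDecayDirection_one_add_mul_I {η lam : ℝ} (hη : 0 < η) (hlam : -1 ≤ η * Real.log lam) :
    IsDecayDirection lam (1 + η * Complex.I) where
  re_pos := by simp
  im_pos := by simpa using hη
  rate_pos := by
    simp only [decayRate, Complex.add_re, Complex.add_im, Complex.one_re, Complex.one_im,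
      Complex.re_ofReal_mul, Complex.im_ofReal_mul, Complex.I_re, Complex.I_im]
    linarith [Real.pi_gt_three]

theorem norm_JB_sub_le {δ t lam φ a B : ℝ} {n : ℕ} (hδ : 0 ≤ δ) (ht : 1 < t)
    (hp : t ^ (δ - 1) ≤ 1 / 2) (ha0 : 0 < a) (ha1 : a ≤ 1 / 2) (hone : 1 ≤ a * t ^ (δ / 2))
    (hlam : lamC δ t ≤ lam) (hφ : AdmissibleAngle lam φ)
    (htail : ∀ (g : ℂ → ℂ) (L : ℂ),
      (∀ R, 0 ≤ R → HasDerivAt g (halfIntegrand t lam (slantRay (splitK δ t a) (Real.log t)⁻¹ R))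
        (slantRay (splitK δ t a) (Real.log t)⁻¹ R)) →
      Tendsto (fun R => g (slantRay (splitK δ t a) (Real.log t)⁻¹ R)) atTop (nhds L) →
      ‖L - g ((1 - splitK δ t a : ℝ) : ℂ) - ∑ j ∈ Finset.range n, T t lam (splitK δ t a) j‖ ≤ B) :
    ‖JB δ (1 / 2) t lam φ - (∑ j ∈ Finset.range n, T t lam (splitK δ t a) j)
      - fresnelTerm δ t lam a‖ ≤ B + 9 * err₂ δ t a := by
  have ht0 : 0 < t := by linarith
  have hp0 : 0 < t ^ (δ - 1) := Real.rpow_pos_of_pos ht0 _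
  have hk0 : 0 < splitK δ t a := splitK_pos ht0 (by linarith)
  have hk1 : splitK δ t a ≤ t ^ (δ - 1) := splitK_le ht0 ha0.le
  have hdir : IsDecayDirection lam (1 + ((Real.log t)⁻¹ : ℝ) * Complex.I) :=
    isDecayDirection_one_add_mul_I (inv_pos.2 (Real.log_pos ht))
      (neg_one_le_inv_log_mul_log hδ ht (by linarith) hlam)
  obtain ⟨g, hreal, hray, hlim⟩ := exists_primitive_tendsto_JB (δ := δ) (x := 1 - splitK δ t a)
    ht0 (by rw [z₀]; linarith) (by rw [z₀]; linarith) hφ (by linarith) (by linarith) hdir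
  have hfar := htail g _ hray hlim
  have hnear := (norm_sub_fresnelTerm_le ht0 hp ((lamC_pos ht0 (by linarith)).trans_le hlam)
    ha0 ha1 hreal).trans (sqrt_mul_le_err₂ ht0 hone)
  calc ‖JB δ (1 / 2) t lam φ - (∑ j ∈ Finset.range n, T t lam (splitK δ t a) j)
        - fresnelTerm δ t lam a‖
      = ‖(g (z₀ δ t) + JB δ (1 / 2) t lam φ - g ((1 - splitK δ t a : ℝ) : ℂ)
            - ∑ j ∈ Finset.range n, T t lam (splitK δ t a) j)
          + (g ((1 - splitK δ t a : ℝ) : ℂ) - g (z₀ δ t) - fresnelTerm δ t lam a)‖ := by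
        congr 1
        ring
    _ ≤ B + 9 * err₂ δ t a := (norm_add_le _ _).trans (add_le_add hfar hnear)

end JBAsymptotics

open JBAsymptotics in
theorem theorem2_general :
    ∃ C : ℝ, 0 < C ∧
      ∀ (δ : ℝ), 0 < δ → δ < 1 →
      ∀ (m : ℕ), 2 ≤ m →
      ∀ (γ : ℝ), 0 < γ →
      ∀ (a : ℝ → ℝ), (∀ᶠ t in atTop, 0 < a t) →
        (fun t : ℝ => t ^ (γ - δ / 2)) =O[atTop] a →
        a =O[atTop] (fun t : ℝ => t ^ (-(δ / 2) + δ / (4 * (m : ℝ) - 2))) →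
        ∀ᶠ t in atTop, ∀ lam : ℝ, t ^ (δ - 1) / (1 - t ^ (δ - 1)) ≤ lam →
          (∀ φ : ℝ, AdmissibleAngle lam φ →
            IntegrableOn (rayIntegrand δ (1 / 2) t lam φ) (Set.Ioi 0) ∧
            ‖JB δ (1 / 2) t lam φ - (∑ j ∈ Finset.range (m - 2), T t lam (splitK δ t (a t)) j)
                - fresnelTerm δ t lam (a t)‖
              ≤ C * (err₁ δ m t (a t) + err₂ δ t (a t))) ∧
          (∀ j ∈ Finset.range (m - 2),
            ‖T t lam (splitK δ t (a t)) j‖ ≤ C * boundT δ j t (a t)) := by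
  refine ⟨9, by norm_num, fun δ hδ0 hδ1 m hm γ hγ a ha hlow hup => ?_⟩
  have ha0 := tendsto_zero_of_isBigO hδ0 hm hup
  have hgrowth := eventually_rpow_le_mul (half_lt_self hγ) ha hlow
  obtain ⟨M, hM0, hM⟩ :=
    exists_eventually_norm_tail_le hδ0.le hδ1 (half_pos hγ) ha ha0 hgrowth (m - 2)
  filter_upwards [ha, ha0.eventually_le_const one_half_pos,
    (tendsto_rpow_sub_one hδ1).eventually_le_const one_half_pos, eventually_gt_atTop 1, hgrowth,
    hM, eventually_mul_le_err₁ hm ha hup hM0,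
    (eventually_all_finset (Finset.range (m - 2))).2
      fun j _ => eventually_norm_T_le hδ1 ha ha0 j]
    with t hat hat1 hp ht hgrow htail herr hT lam hlam
  have hone : 1 ≤ a t * t ^ (δ / 2) := (Real.one_le_rpow ht.le (half_pos hγ).le).trans hgrow
  have herr0 : 0 ≤ err₁ δ m t (a t) := le_trans (by positivity) herr
  refine ⟨fun φ hφ => ⟨integrableOn_rayIntegrand (by linarith) (by rw [z₀]; linarith)
    (by rw [z₀]; linarith [Real.rpow_pos_of_pos (one_pos.trans ht) (δ - 1)]) hφ, ?_⟩,
    fun j hj => (hT j hj lam hlam).trans ?_⟩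
  · linarith [norm_JB_sub_le hδ0.le ht hp hat hat1 hone hlam hφ (htail lam hlam)]
  · have : 0 ≤ boundT δ j t (a t) := by rw [boundT]; positivity
    linarith

theorem theorem2 (δ : ℝ) (hδ0 : 0 < δ) (hδ1 : δ < 1) :
    ∃ C : ℝ, 0 < C ∧
      ∀ (m : ℕ), 4 ≤ m →
      ∀ (ε : ℝ), 0 < ε →
      ∀ (a : ℝ → ℝ), (∀ᶠ t in atTop, 0 < a t) →
        (fun t : ℝ => t ^ (ε - δ / 2 + δ / (4 * (m : ℝ) + 2))) =O[atTop] a →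
        a =O[atTop] (fun t : ℝ => t ^ (-(δ / 2) + δ / (4 * (m : ℝ) - 2))) →
        ∀ᶠ t in atTop, ∀ lam : ℝ,
          t ^ (δ - 1) / (1 - t ^ (δ - 1)) ≤ lam → lam ≤ t ^ (1 - δ) - 1 →
          (∀ φ : ℝ, JBAsymptotics.AdmissibleAngle lam φ →
            IntegrableOn (JBAsymptotics.rayIntegrand δ (1 / 2) t lam φ) (Set.Ioi 0) ∧
            ‖JBAsymptotics.JB δ (1 / 2) t lam φ
                - (∑ j ∈ Finset.range (m - 2),
                    JBAsymptotics.T t lam (JBAsymptotics.splitK δ t (a t)) j)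
                - JBAsymptotics.fresnelTerm δ t lam (a t)‖
              ≤ C * (JBAsymptotics.err₁ δ m t (a t) + JBAsymptotics.err₂ δ t (a t))) ∧
          (∀ j ∈ Finset.range (m - 2),
            ‖JBAsymptotics.T t lam (JBAsymptotics.splitK δ t (a t)) j‖
              ≤ C * JBAsymptotics.boundT δ j t (a t)) := by
  obtain ⟨C, hC, h⟩ := theorem2_general
  refine ⟨C, hC, fun m hm ε hε a ha hlow hup => ?_⟩
  simp only [sub_add_eq_add_sub] at hlow
  exact (h δ hδ0 hδ1 m (by omega) _ (by positivity) a ha hlow hup).mono fun t ht lam h _ => ht lam h
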